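/- Let $(M,g)$ and $(Q,\tilde g)$ be smooth finite-dimensional Riemannian manifolds without boundary, with Levi-Civita connections $\nabla$ and $\widetilde\nabla$, and let $\iota\colon M\to Q$ be a smooth isometric immersion (of arbitrary codimension, not necessarily injective), with second fundamental form $\alpha$, defined by the Gauss formula $\widetilde\nabla_X Y=\nabla_X Y+\alpha(X,Y)$. A smooth unit-speed curve $c\colon I\to Q$ on an open interval $I$, with velocity $T$, is called \emph{planar} if there are a smooth field $Y$ of unit vectors along $c$ and a smooth function $\kappa\colon I\to\mathbb R$ such that $$\widetilde\nabla_T T=\kappa Y,\qquad \widetilde\nabla_T Y=-\kappa T ;$$ it is called a \emph{circle} if this holds with $\kappa$ equal to a positive constant. The \emph{extrinsic shape} of a curve $\gamma$ in $M$ is the curve $\iota\circ\gamma$. The immersion $\iota$ is \emph{totally isotropic} if for every $p\in M$ there is a number $\lambda_p$ such that $\langle\alpha(x,x),\alpha(x,x)\rangle=\lambda_p$ for all unit vectors $x\in T_pM$; it is \emph{constant isotropic} if $\lambda_p=\lambda$ can be chosen independently of $p$; and it is \emph{totally geodesic} if $\alpha$ vanishes identically. Theorem. (1) If the extrinsic shape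 of every unit-speed geodesic $\gamma\colon I\to M$, $I$ an open interval, is planar, then $\iota$ is totally isotropic. (2) Suppose in addition that $M$ is connected (in particular nonempty) and $\dim M\ge 1$. If the extrinsic shape of every unit-speed geodesic $\gamma\colon I\to M$, $I$ an open interval, is a circle, then $\iota$ is constant isotropic and not totally geodesic. -/

import Mathlib

open Bundle Manifold Set
open scoped ContDiff Topology

noncomputable section

namespace RiemannianGeometry

variable {E : Type*} [NormedAddCommGroup E] [NormedSpace ℝ E]
  {M : Type*} [TopologicalSpace M] [ChartedSpace E M] [IsManifold 𝓘(ℝ, E) ∞ M]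
  {F : Type*} [NormedAddCommGroup F] [NormedSpace ℝ F]
  {N : Type*} [TopologicalSpace N] [ChartedSpace F N] [IsManifold 𝓘(ℝ, F) ∞ N]

variable (E M) in
/-- A smooth Riemannian metric on a smooth boundaryless manifold `M` modelled on `E`. -/
abbrev Metric : Type _ :=
  ContMDiffRiemannianMetric 𝓘(ℝ, E) ∞ E (fun p : M => TangentSpace 𝓘(ℝ, E) p)

/-- The coordinate vector field, in the preferred chart at `p`, whose value at `p` is `u`: near `p`
it has the constant components `u` in that chart. -/
def coordField (p : M) (u : E) (q : M) : TangentSpace 𝓘(ℝ, E) q :=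
  (trivializationAt E (TangentSpace 𝓘(ℝ, E) : M → Type _) p).symmL ℝ q u

/-- The components, in the preferred chart at `p`, of a vector `v` tangent to `M` at a point `q`
near `p`. -/
def coord (p q : M) (v : TangentSpace 𝓘(ℝ, E) q) : E :=
  (trivializationAt E (TangentSpace 𝓘(ℝ, E) : M → Type _) p ⟨q, v⟩).2

/-- The components `g_{ij}` of the metric in the preferred chart at `p`, at a point `q` near `p`. -/
def gram (g : Metric E M) (p q : M) : E →L[ℝ] E →L[ℝ] ℝ :=
  letI S : E →L[ℝ] TangentSpace 𝓘(ℝ, E) q :=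
    (trivializationAt E (TangentSpace 𝓘(ℝ, E) : M → Type _) p).symmL ℝ q
  (S.precomp ℝ).comp ((g.inner q).comp S)

theorem gram_apply (g : Metric E M) (p q : M) (u v : E) :
    gram g p q u v = g.inner q (coordField p u q) (coordField p v q) := rfl

/-- The derivative at `p` of the components of the metric in the preferred chart at `p`. -/
def dgram (g : Metric E M) (p : M) : E →L[ℝ] E →L[ℝ] E →L[ℝ] ℝ :=
  mfderiv 𝓘(ℝ, E) 𝓘(ℝ, E →L[ℝ] E →L[ℝ] ℝ) (gram g p) p

/-- The right-hand side of the Koszul formula for coordinate vector fields,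
`w ↦ (∂_u g(v, w) + ∂_v g(u, w) - ∂_w g(u, v)) / 2`, at the base point `p` of the chart. -/
def koszul (g : Metric E M) (p : M) (u v : E) : E →L[ℝ] ℝ :=
  (2⁻¹ : ℝ) • (dgram g p u v + dgram g p v u - ((dgram g p).flip u).flip v)

/-- The Christoffel symbol `Γ(u, v)` of the Levi-Civita connection at `p`, in the preferred chart
at `p`: the vector with `g(Γ(u, v), w) = koszul u v w` for all `w` (see `inner_christoffel`).
A tangent vector at `p` is identified with its components in the preferred chart at `p`, as Mathlib
does by definition. -/
def christoffel (g : Metric E M) (p : M) (u v : TangentSpace 𝓘(ℝ, E) p) :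
    TangentSpace 𝓘(ℝ, E) p :=
  (g.inner p).inverse (koszul (E := E) g p u v)

theorem apply_inverse_apply [FiniteDimensional ℝ E] (G : E →L[ℝ] E →L[ℝ] ℝ)
    (hG : ∀ v, v ≠ 0 → 0 < G v v) (φ : E →L[ℝ] ℝ) : G (G.inverse φ) = φ := by
  have hinj : Function.Injective G.toLinearMap := by
    rw [← LinearMap.ker_eq_bot, LinearMap.ker_eq_bot']
    intro v hv
    by_contra hne
    have h1 := hG v hne
    have h2 : G v = 0 := hv
    simp [h2] at h1
  have hfr : Module.finrank ℝ E = Module.finrank ℝ (E →L[ℝ] ℝ) := by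
    rw [← (LinearMap.toContinuousLinearMap (𝕜 := ℝ) (E := E) (F' := ℝ)).finrank_eq]
    exact (Subspace.dual_finrank_eq (K := ℝ) (V := E)).symm
  have hI : G.IsInvertible :=
    ⟨(LinearMap.linearEquivOfInjective G.toLinearMap hinj hfr).toContinuousLinearEquiv, by
      ext; rfl⟩
  exact ((hI.inverse_apply_eq (x := G.inverse φ) (y := φ)).1 rfl).symm

theorem inner_christoffel [FiniteDimensional ℝ E] (g : Metric E M) (p : M)
    (u v w : TangentSpace 𝓘(ℝ, E) p) :
    g.inner p (christoffel g p u v) w = koszul (E := E) g p u v w := by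
  exact congrArg (fun φ : E →L[ℝ] ℝ => φ w)
    (apply_inverse_apply (E := E) (g.inner p) (g.pos p) (koszul (E := E) g p u v))

/-- The Levi-Civita covariant derivative of a vector field `W` along a map `f : N → M`, at the
point `q` of `N` in the direction `x ∈ T_q N`. In the preferred chart of `M` at `f q` it is
`∂_x W + Γ(df x, W)`. -/
def covDerivAlong (g : Metric E M) (f : N → M) (W : ∀ q : N, TangentSpace 𝓘(ℝ, E) (f q))
    (q : N) (x : TangentSpace 𝓘(ℝ, F) q) : TangentSpace 𝓘(ℝ, E) (f q) :=
  letI dW : TangentSpace 𝓘(ℝ, E) (f q) :=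
    (mfderiv 𝓘(ℝ, F) 𝓘(ℝ, E) (fun r : N => coord (f q) (f r) (W r)) q x : E)
  dW + christoffel g (f q) (mfderiv 𝓘(ℝ, F) 𝓘(ℝ, E) f q x) (W q)

/-- The Levi-Civita covariant derivative `∇_x Y` of a vector field `Y` on `M`. -/
def covDeriv (g : Metric E M) (Y : ∀ q : M, TangentSpace 𝓘(ℝ, E) q) (p : M)
    (x : TangentSpace 𝓘(ℝ, E) p) : TangentSpace 𝓘(ℝ, E) p :=
  covDerivAlong g (fun q : M => q) Y p x

/-- The velocity vector of a curve. -/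
def velocity (γ : ℝ → M) (t : ℝ) : TangentSpace 𝓘(ℝ, E) (γ t) :=
  mfderiv 𝓘(ℝ, ℝ) 𝓘(ℝ, E) γ t (1 : ℝ)

/-- The covariant derivative `∇_T V` of a vector field `V` along the curve `γ` with velocity
`T`. -/
def covDerivCurve (g : Metric E M) (γ : ℝ → M) (V : ∀ t : ℝ, TangentSpace 𝓘(ℝ, E) (γ t)) (t : ℝ) :
    TangentSpace 𝓘(ℝ, E) (γ t) :=
  covDerivAlong (F := ℝ) g γ V t (1 : ℝ)

/-- `γ` is a smooth unit-speed curve on `J`, with respect to the metric `g`. -/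
structure IsUnitSpeedCurve (g : Metric E M) (γ : ℝ → M) (J : Set ℝ) : Prop where
  smooth : ContMDiffOn 𝓘(ℝ, ℝ) 𝓘(ℝ, E) ∞ γ J
  unit_speed : ∀ t ∈ J, g.inner (γ t) (velocity γ t) (velocity γ t) = 1

/-- `γ` is a unit-speed geodesic on `J`. -/
structure IsGeodesic (g : Metric E M) (γ : ℝ → M) (J : Set ℝ) : Prop
    extends IsUnitSpeedCurve g γ J where
  geodesic : ∀ t ∈ J, covDerivCurve g γ (velocity γ) t = 0

/-- `Y` is a smooth field of unit vectors along `γ` on `J`, and `∇_T T = κ Y`,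
`∇_T Y = - κ T`, where `T` is the velocity of `γ`. -/
structure PlanarSystem (g : Metric E M) (γ : ℝ → M) (J : Set ℝ)
    (Y : ∀ t : ℝ, TangentSpace 𝓘(ℝ, E) (γ t)) (κ : ℝ → ℝ) : Prop where
  smooth : ContMDiffOn 𝓘(ℝ, ℝ) 𝓘(ℝ, E).tangent ∞
    (fun t => (⟨γ t, Y t⟩ : TangentBundle 𝓘(ℝ, E) M)) J
  unit : ∀ t ∈ J, g.inner (γ t) (Y t) (Y t) = 1
  deriv_T : ∀ t ∈ J, covDerivCurve g γ (velocity γ) t = κ t • Y t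
  deriv_Y : ∀ t ∈ J, covDerivCurve g γ Y t = -(κ t • velocity γ t)

/-- `γ` is a planar curve on `J`. -/
def IsPlanar (g : Metric E M) (γ : ℝ → M) (J : Set ℝ) : Prop :=
  IsUnitSpeedCurve g γ J ∧
    ∃ (Y : ∀ t : ℝ, TangentSpace 𝓘(ℝ, E) (γ t)) (κ : ℝ → ℝ),
      ContDiffOn ℝ ∞ κ J ∧ PlanarSystem g γ J Y κ

/-- `γ` is a circle on `J`: a planar curve with constant `κ > 0`. -/
def IsCircle (g : Metric E M) (γ : ℝ → M) (J : Set ℝ) : Prop :=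
  IsUnitSpeedCurve g γ J ∧
    ∃ (Y : ∀ t : ℝ, TangentSpace 𝓘(ℝ, E) (γ t)) (k : ℝ),
      0 < k ∧ PlanarSystem g γ J Y (fun _ => k)

/-- `ι` is an isometric immersion of `(N, h)` into `(M, g)`. (Injectivity of the differential
follows from the preservation of the metrics.) -/
structure IsIsometricImmersion (h : Metric F N) (g : Metric E M) (ι : N → M) : Prop where
  smooth : ContMDiff 𝓘(ℝ, F) 𝓘(ℝ, E) ∞ ι
  isometric : ∀ (p : N) (x y : TangentSpace 𝓘(ℝ, F) p),
    g.inner (ι p) (mfderiv 𝓘(ℝ, F) 𝓘(ℝ, E) ι p x) (mfderiv 𝓘(ℝ, F) 𝓘(ℝ, E) ι p y)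
      = h.inner p x y

/-- The second fundamental form `α(x, y)` of `ι : (N, h) → (M, g)`, by the Gauss formula
`∇̃_x (dι Y) = dι (∇_x Y) + α(x, y)`, where `Y` is the coordinate vector field with `Y(p) = y`,
`∇̃` is the Levi-Civita connection of `g`, and `∇` that of `h`. -/
def secondFundamentalForm (h : Metric F N) (g : Metric E M) (ι : N → M) (p : N)
    (x y : TangentSpace 𝓘(ℝ, F) p) : TangentSpace 𝓘(ℝ, E) (ι p) :=
  covDerivAlong g ι (fun q => mfderiv 𝓘(ℝ, F) 𝓘(ℝ, E) ι q (coordField (E := F) p y q)) p x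
    - mfderiv 𝓘(ℝ, F) 𝓘(ℝ, E) ι p (covDeriv h (coordField (E := F) p y) p x)

/-- `|α(x, x)|² = l` for all unit vectors `x` tangent at `p`. -/
def IsIsotropicAt (h : Metric F N) (g : Metric E M) (ι : N → M) (p : N) (l : ℝ) : Prop :=
  ∀ x : TangentSpace 𝓘(ℝ, F) p, h.inner p x x = 1 →
    g.inner (ι p) (secondFundamentalForm h g ι p x x) (secondFundamentalForm h g ι p x x) = l

/-- `ι` is totally isotropic: isotropic at every point. -/
def IsTotallyIsotropic (h : Metric F N) (g : Metric E M) (ι : N → M) : Prop :=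
  ∀ p : N, ∃ l : ℝ, IsIsotropicAt h g ι p l

/-- `ι` is constant isotropic: isotropic at every point, with the same constant. -/
def IsConstantIsotropic (h : Metric F N) (g : Metric E M) (ι : N → M) : Prop :=
  ∃ l : ℝ, ∀ p : N, IsIsotropicAt h g ι p l

/-- `ι` is totally geodesic: its second fundamental form vanishes. -/
def IsTotallyGeodesic (h : Metric F N) (g : Metric E M) (ι : N → M) : Prop :=
  ∀ (p : N) (x y : TangentSpace 𝓘(ℝ, F) p), secondFundamentalForm h g ι p x y = 0

end RiemannianGeometry

end

/-!
The theorem rests on two infinitesimal computations and on the local existence of geodesics.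

Let `γ` be a geodesic of `M` with velocity `T`. By the Gauss formula (`covDerivCurve_comp`) the
covariant acceleration of `ι ∘ γ` is `α(T, T)`, which is normal to `ι`
(`secondFundamentalForm_normal`). If `ι ∘ γ` is planar, `α(T, T) = κ Y`, so `κ ⟨Y, dι y⟩ = 0`
along `γ` for every field `y` tangent to `M`. Differentiating this and using `∇_T Y = -κ T` gives
`⟨α(T, T), α(T, y)⟩ = 0` whenever `y ⊥ T` (`IsGeodesic.inner_secondFundamentalForm_eq_zero`).
Since every unit vector is the velocity of a geodesic (`exists_isGeodesic`), a polynomial identity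
in the plane of an orthonormal pair shows that `|α(x, x)|²` is the same for all unit vectors `x`
at a point (`inner_self_eq_of_orthogonal`), which is total isotropy.

If the extrinsic shapes are circles, `|α(T, T)|²` is a positive constant along each geodesic, so
`ι` is not totally geodesic. In a chart the isotropy function is `|α(u, u)|² / |u|⁴` for a fixed
coordinate vector `u`, hence differentiable, and its derivative vanishes in every direction
because the function is constant along geodesics. So it is locally constant
(`eventually_isotropy_eq`), and constant on a connected `M`.

The connection is defined at each point through the chart preferred at that point, whereas a
geodesic and the isotropy function have to be followed in one fixed chart. All computations are
therefore made for a metric on an open subset of a vector space. There the differentiated isometry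
condition shows that the second fundamental form of an isometric immersion is normal
(`IsLocalIsometry.localSecondForm_normal`). Applied to the immersion read in charts, this is the
normality of `α`. Applied to a change of charts, whose differential is onto, it says that the
second fundamental form vanishes, which is the transformation law of the Christoffel symbols
(`coord_covDerivCurve_velocity`).
-/

set_option maxSynthPendingDepth 3
set_option linter.unusedSectionVars false

noncomputable section

namespace RiemannianGeometry

/-! ### Metrics, Christoffel symbols and isometric immersions in a vector space -/

section LocalModel

variable {E : Type*} [NormedAddCommGroup E] [NormedSpace ℝ E]
  {F : Type*} [NormedAddCommGroup F] [NormedSpace ℝ F]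
  {X : Type*} [NormedAddCommGroup X] [NormedSpace ℝ X]

/-- A Riemannian metric on an open subset `U` of a vector space, given by its Gram form. -/
structure IsLocalMetric (G : E → E →L[ℝ] E →L[ℝ] ℝ) (U : Set E) : Prop where
  isOpen : IsOpen U
  contDiffOn : ContDiffOn ℝ ∞ G U
  symm : ∀ x ∈ U, ∀ u v, G x u v = G x v u
  pos : ∀ x ∈ U, ∀ v, v ≠ 0 → 0 < G x v v

/-- The right-hand side of the Koszul formula for constant vector fields. -/
def localKoszul (G : E → E →L[ℝ] E →L[ℝ] ℝ) (x u v : E) : E →L[ℝ] ℝ :=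
  (2⁻¹ : ℝ) • (fderiv ℝ G x u v + fderiv ℝ G x v u - ((fderiv ℝ G x).flip u).flip v)

/-- The Christoffel symbol `Γ(u, v)` at `x` of the Levi-Civita connection of `G`: the vector
representing `localKoszul G x u v`, see `IsLocalMetric.inner_localChristoffel`. It is meaningful
where `G x` is invertible, in particular on the domain of a metric. -/
def localChristoffel (G : E → E →L[ℝ] E →L[ℝ] ℝ) (x u v : E) : E :=
  (G x).inverse (localKoszul G x u v)

/-- The covariant acceleration `c'' + Γ(c', c')` of a curve. -/
def localAccel (G : E → E →L[ℝ] E →L[ℝ] ℝ) (c : ℝ → E) (t : ℝ) : E :=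
  deriv (deriv c) t + localChristoffel G (c t) (deriv c t) (deriv c t)

/-- The second fundamental form `D²ψ(u, v) + Γ'(dψ u, dψ v) - dψ Γ(u, v)` of `ψ`, as a map from
`(E, G)` to `(F, G')`. -/
def localSecondForm (G : E → E →L[ℝ] E →L[ℝ] ℝ) (G' : F → F →L[ℝ] F →L[ℝ] ℝ) (ψ : E → F)
    (x u v : E) : F :=
  fderiv ℝ (fderiv ℝ ψ) x u v + localChristoffel G' (ψ x) (fderiv ℝ ψ x u) (fderiv ℝ ψ x v)
    - fderiv ℝ ψ x (localChristoffel G x u v)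

/-- `ψ` is a smooth isometric immersion of `(U, G)` into `(V, G')`. -/
structure IsLocalIsometry (G : E → E →L[ℝ] E →L[ℝ] ℝ) (U : Set E)
    (G' : F → F →L[ℝ] F →L[ℝ] ℝ) (V : Set F) (ψ : E → F) : Prop where
  source : IsLocalMetric G U
  target : IsLocalMetric G' V
  contDiffOn : ContDiffOn ℝ ∞ ψ U
  mapsTo : MapsTo ψ U V
  isometric : ∀ x ∈ U, ∀ u v, G x u v = G' (ψ x) (fderiv ℝ ψ x u) (fderiv ℝ ψ x v)

variable {G : E → E →L[ℝ] E →L[ℝ] ℝ} {U : Set E} {G' : F → F →L[ℝ] F →L[ℝ] ℝ} {V : Set F}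
  {ψ : E → F}

theorem localKoszul_apply (x u v w : E) : localKoszul G x u v w =
    2⁻¹ * (fderiv ℝ G x u v w + fderiv ℝ G x v u w - fderiv ℝ G x w u v) := by
  simp [localKoszul]

theorem localChristoffel_add_left (x u₁ u₂ v : E) :
    localChristoffel G x (u₁ + u₂) v = localChristoffel G x u₁ v + localChristoffel G x u₂ v := by
  unfold localChristoffel
  rw [← map_add]
  congr 1
  ext w
  simp only [localKoszul_apply, add_apply, map_add]
  ring

theorem localChristoffel_smul_left (a : ℝ) (x u v : E) :
    localChristoffel G x (a • u) v = a • localChristoffel G x u v := by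
  unfold localChristoffel
  rw [← map_smul]
  congr 1
  ext w
  simp only [localKoszul_apply, smul_apply, map_smul, smul_eq_mul]
  ring

theorem contDiffAt_deriv {c : ℝ → E} {t : ℝ} (hc : ContDiffAt ℝ ∞ c t) :
    ContDiffAt ℝ ∞ (deriv c) t :=
  (hc.fderiv_right (m := ∞) (by simp)).clm_apply contDiffAt_const

namespace IsLocalMetric

theorem contDiffAt (hG : IsLocalMetric G U) {x : E} (hx : x ∈ U) : ContDiffAt ℝ ∞ G x :=
  hG.contDiffOn.contDiffAt (hG.isOpen.mem_nhds hx)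

theorem differentiableAt (hG : IsLocalMetric G U) {x : E} (hx : x ∈ U) : DifferentiableAt ℝ G x :=
  (hG.contDiffAt hx).differentiableAt (by simp)

/-- The product rule for `G(a, b)` along a curve, in terms of ordinary derivatives. -/
theorem hasDerivAt (hG : IsLocalMetric G U) {c a b : ℝ → E} {c' a' b' : E} {t : ℝ}
    (ht : c t ∈ U) (hc : HasDerivAt c c' t) (ha : HasDerivAt a a' t) (hb : HasDerivAt b b' t) :
    HasDerivAt (fun s => G (c s) (a s) (b s))
      (fderiv ℝ G (c t) c' (a t) (b t) + G (c t) a' (b t) + G (c t) (a t) b') t := by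
  have h1 := ((hG.differentiableAt ht).hasFDerivAt.comp_hasDerivAt t hc)
  simpa using (h1.clm_apply ha).clm_apply hb

theorem fderiv_symm (hG : IsLocalMetric G U) {x : E} (hx : x ∈ U) (w u v : E) :
    fderiv ℝ G x w u v = fderiv ℝ G x w v u := by
  have hc : HasDerivAt (fun s : ℝ => x + s • w) w 0 := by
    simpa using ((hasDerivAt_id (0 : ℝ)).smul_const w).const_add x
  have hx0 : (fun s : ℝ => x + s • w) 0 ∈ U := by simpa using hx
  have h1 := hG.hasDerivAt hx0 hc (hasDerivAt_const 0 u) (hasDerivAt_const 0 v)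
  have h2 := hG.hasDerivAt hx0 hc (hasDerivAt_const 0 v) (hasDerivAt_const 0 u)
  have h3 : (fun s : ℝ => G (x + s • w) u v) =ᶠ[𝓝 0] fun s : ℝ => G (x + s • w) v u := by
    filter_upwards [hc.continuousAt.preimage_mem_nhds (hG.isOpen.mem_nhds hx0)] with s hs
    exact hG.symm _ hs _ _
  simpa using (h1.congr_of_eventuallyEq h3.symm).unique h2

theorem localChristoffel_symm (hG : IsLocalMetric G U) {x : E} (hx : x ∈ U) (u v : E) :
    localChristoffel G x u v = localChristoffel G x v u := by
  unfold localChristoffel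
  congr 1
  ext w
  simp only [localKoszul_apply]
  rw [hG.fderiv_symm hx w u v]
  ring

variable [FiniteDimensional ℝ E]

theorem inner_localChristoffel (hG : IsLocalMetric G U) {x : E} (hx : x ∈ U) (u v w : E) :
    G x (localChristoffel G x u v) w = localKoszul G x u v w :=
  congrArg (fun φ : E →L[ℝ] ℝ => φ w) (apply_inverse_apply (G x) (hG.pos x hx) _)

/-- Compatibility of the connection with the metric. -/
theorem fderiv_eq (hG : IsLocalMetric G U) {x : E} (hx : x ∈ U) (w u v : E) :
    fderiv ℝ G x w u v =
      G x (localChristoffel G x w u) v + G x u (localChristoffel G x w v) := by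
  rw [hG.symm x hx u, hG.inner_localChristoffel hx, hG.inner_localChristoffel hx,
    localKoszul_apply, localKoszul_apply, hG.fderiv_symm hx w u v, hG.fderiv_symm hx u w v,
    hG.fderiv_symm hx v w u]
  ring

theorem isInvertible (hG : IsLocalMetric G U) {x : E} (hx : x ∈ U) : (G x).IsInvertible := by
  have hinj : Function.Injective (G x).toLinearMap := by
    refine (injective_iff_map_eq_zero _).2 fun v hv => ?_
    by_contra hne
    have h1 := hG.pos x hx v hne
    have h2 : G x v = 0 := hv
    simp [h2] at h1
  have hsurj : Function.Surjective (G x).toLinearMap := fun φ =>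
    ⟨_, apply_inverse_apply (G x) (hG.pos x hx) φ⟩
  exact ⟨(LinearEquiv.ofBijective (G x).toLinearMap ⟨hinj, hsurj⟩).toContinuousLinearEquiv, by
    ext; rfl⟩

theorem contDiffAt_localChristoffel (hG : IsLocalMetric G U) {c a b : X → E} {z : X}
    (hz : c z ∈ U) (hc : ContDiffAt ℝ ∞ c z) (ha : ContDiffAt ℝ ∞ a z)
    (hb : ContDiffAt ℝ ∞ b z) :
    ContDiffAt ℝ ∞ (fun y => localChristoffel G (c y) (a y) (b y)) z := by
  have h1 : ContDiffAt ℝ ∞ (fun y => (G (c y)).inverse) z :=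
    ContDiffAt.comp z (g := ContinuousLinearMap.inverse)
      (hG.isInvertible hz).contDiffAt_map_inverse ((hG.contDiffAt hz).comp z hc)
  have h2 : ContDiffAt ℝ ∞ (fun y => fderiv ℝ G (c y)) z :=
    ((hG.contDiffAt hz).fderiv_right (m := ∞) (by simp)).comp z hc
  have h4 : ContDiffAt ℝ ∞ (fun y => (fderiv ℝ G (c y)).flip) z :=
    (ContinuousLinearMap.flipₗᵢ ℝ E E (E →L[ℝ] ℝ)).contDiff.contDiffAt.comp z h2
  have h3 : ContDiffAt ℝ ∞ (fun y => ((fderiv ℝ G (c y)).flip (a y)).flip (b y)) z :=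
    ((ContinuousLinearMap.flipₗᵢ ℝ E E ℝ).contDiff.contDiffAt.comp z
      (h4.clm_apply ha)).clm_apply hb
  exact h1.clm_apply
    ((((h2.clm_apply ha).clm_apply hb).add ((h2.clm_apply hb).clm_apply ha)).sub h3 |>.const_smul _)

end IsLocalMetric

namespace IsLocalIsometry

theorem contDiffAt (h : IsLocalIsometry G U G' V ψ) {x : E} (hx : x ∈ U) : ContDiffAt ℝ ∞ ψ x :=
  h.contDiffOn.contDiffAt (h.source.isOpen.mem_nhds hx)

theorem differentiableAt (h : IsLocalIsometry G U G' V ψ) {x : E} (hx : x ∈ U) :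
    DifferentiableAt ℝ ψ x :=
  (h.contDiffAt hx).differentiableAt (by simp)

theorem contDiffAt_fderiv (h : IsLocalIsometry G U G' V ψ) {x : E} (hx : x ∈ U) :
    ContDiffAt ℝ ∞ (fderiv ℝ ψ) x :=
  (h.contDiffAt hx).fderiv_right (by simp)

theorem hasDerivAt_fderiv (h : IsLocalIsometry G U G' V ψ) {c a : ℝ → E} {c' a' : E} {t : ℝ}
    (ht : c t ∈ U) (hc : HasDerivAt c c' t) (ha : HasDerivAt a a' t) :
    HasDerivAt (fun s => fderiv ℝ ψ (c s) (a s))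
      (fderiv ℝ (fderiv ℝ ψ) (c t) c' (a t) + fderiv ℝ ψ (c t) a') t :=
  ((((h.contDiffAt_fderiv ht).differentiableAt (by simp)).hasFDerivAt.comp_hasDerivAt t
    hc).clm_apply ha)

theorem snd_fderiv_symm (h : IsLocalIsometry G U G' V ψ) {x : E} (hx : x ∈ U) (u v : E) :
    fderiv ℝ (fderiv ℝ ψ) x u v = fderiv ℝ (fderiv ℝ ψ) x v u :=
  (h.contDiffAt hx).isSymmSndFDerivAt (by simpa using ENat.LEInfty.out) u v

theorem localSecondForm_symm (h : IsLocalIsometry G U G' V ψ) {x : E} (hx : x ∈ U) (u v : E) :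
    localSecondForm G G' ψ x u v = localSecondForm G G' ψ x v u := by
  unfold localSecondForm
  rw [h.snd_fderiv_symm hx, h.source.localChristoffel_symm hx,
    h.target.localChristoffel_symm (h.mapsTo hx)]

theorem localSecondForm_add_left (x u₁ u₂ v : E) :
    localSecondForm G G' ψ x (u₁ + u₂) v =
      localSecondForm G G' ψ x u₁ v + localSecondForm G G' ψ x u₂ v := by
  simp only [localSecondForm, map_add, localChristoffel_add_left, add_apply]
  abel

theorem localSecondForm_smul_left (a : ℝ) (x u v : E) :
    localSecondForm G G' ψ x (a • u) v = a • localSecondForm G G' ψ x u v := by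
  simp only [localSecondForm, map_smul, localChristoffel_smul_left, smul_apply,
    smul_sub, smul_add]

theorem localSecondForm_add_right (h : IsLocalIsometry G U G' V ψ) {x : E} (hx : x ∈ U)
    (u v₁ v₂ : E) : localSecondForm G G' ψ x u (v₁ + v₂) =
      localSecondForm G G' ψ x u v₁ + localSecondForm G G' ψ x u v₂ := by
  simp only [h.localSecondForm_symm hx u, localSecondForm_add_left]

theorem localSecondForm_smul_right (h : IsLocalIsometry G U G' V ψ) {x : E} (hx : x ∈ U)
    (a : ℝ) (u v : E) :
    localSecondForm G G' ψ x u (a • v) = a • localSecondForm G G' ψ x u v := by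
  simp only [h.localSecondForm_symm hx u, localSecondForm_smul_left]

/-- The derivative of the isometry condition. -/
theorem fderiv_metric (h : IsLocalIsometry G U G' V ψ) {x : E} (hx : x ∈ U) (w u v : E) :
    fderiv ℝ G x w u v =
      fderiv ℝ G' (ψ x) (fderiv ℝ ψ x w) (fderiv ℝ ψ x u) (fderiv ℝ ψ x v)
      + G' (ψ x) (fderiv ℝ (fderiv ℝ ψ) x w u) (fderiv ℝ ψ x v)
      + G' (ψ x) (fderiv ℝ ψ x u) (fderiv ℝ (fderiv ℝ ψ) x w v) := by
  have hc : HasDerivAt (fun s : ℝ => x + s • w) w 0 := by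
    simpa using ((hasDerivAt_id (0 : ℝ)).smul_const w).const_add x
  have hx0 : (fun s : ℝ => x + s • w) 0 ∈ U := by simpa using hx
  have h1 := h.source.hasDerivAt hx0 hc (hasDerivAt_const 0 u) (hasDerivAt_const 0 v)
  have hψ : HasDerivAt (fun s : ℝ => ψ (x + s • w)) (fderiv ℝ ψ x w) 0 := by
    simpa [Function.comp_def] using (h.differentiableAt hx0).hasFDerivAt.comp_hasDerivAt 0 hc
  have h2 := h.target.hasDerivAt (h.mapsTo hx0) hψ
    (h.hasDerivAt_fderiv hx0 hc (hasDerivAt_const 0 u))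
    (h.hasDerivAt_fderiv hx0 hc (hasDerivAt_const 0 v))
  have h3 : (fun s : ℝ => G (x + s • w) u v) =ᶠ[𝓝 0] fun s : ℝ =>
      G' (ψ (x + s • w)) (fderiv ℝ ψ (x + s • w) u) (fderiv ℝ ψ (x + s • w) v) := by
    filter_upwards [hc.continuousAt.preimage_mem_nhds (h.source.isOpen.mem_nhds hx0)] with s hs
    exact h.isometric _ hs _ _
  simpa using (h1.congr_of_eventuallyEq h3.symm).unique h2

/-- The second fundamental form takes values in the normal space: combine the differentiated
isometry condition `fderiv_metric` in three directions as in the Koszul formula. The same fact, for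
a change of coordinates `ψ`, is the transformation law of the Christoffel symbols. -/
theorem localSecondForm_normal [FiniteDimensional ℝ E] [FiniteDimensional ℝ F]
    (h : IsLocalIsometry G U G' V ψ) {x : E} (hx : x ∈ U) (u v w : E) :
    G' (ψ x) (localSecondForm G G' ψ x u v) (fderiv ℝ ψ x w) = 0 := by
  have hV := h.mapsTo hx
  simp only [localSecondForm, map_sub, map_add, add_apply, sub_apply]
  rw [h.target.inner_localChristoffel hV, ← h.isometric x hx, h.source.inner_localChristoffel hx,
    localKoszul_apply, localKoszul_apply, h.fderiv_metric hx, h.fderiv_metric hx,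
    h.fderiv_metric hx, h.snd_fderiv_symm hx w u, h.snd_fderiv_symm hx w v,
    h.snd_fderiv_symm hx v u, h.target.symm _ hV (fderiv ℝ ψ x u),
    h.target.symm _ hV (fderiv ℝ ψ x v) (fderiv ℝ (fderiv ℝ ψ) x u w)]
  ring

/-- The Gauss formula along a curve. -/
theorem localAccel_comp (h : IsLocalIsometry G U G' V ψ) {c : ℝ → E} {t : ℝ} (ht : c t ∈ U)
    (hc : ContDiffAt ℝ ∞ c t) :
    localAccel G' (ψ ∘ c) t = fderiv ℝ ψ (c t) (localAccel G c t)
      + localSecondForm G G' ψ (c t) (deriv c t) (deriv c t) := by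
  have hev : ∀ᶠ s in 𝓝 t, deriv (ψ ∘ c) s = fderiv ℝ ψ (c s) (deriv c s) := by
    filter_upwards [hc.continuousAt.preimage_mem_nhds (h.source.isOpen.mem_nhds ht),
      (hc.of_le (m := 1) (by simp)).eventually (by simp)] with s hs hcs
    exact ((h.differentiableAt hs).hasFDerivAt.comp_hasDerivAt s
      (hcs.differentiableAt (by simp)).hasDerivAt).deriv
  have hd : HasDerivAt (deriv c) (deriv (deriv c) t) t := by
    exact ((contDiffAt_deriv hc).differentiableAt (by simp)).hasDerivAt
  have h2 := (h.hasDerivAt_fderiv ht (hc.differentiableAt (by simp)).hasDerivAt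
    hd).congr_of_eventuallyEq hev
  unfold localAccel localSecondForm
  rw [h2.deriv, hev.self_of_nhds]
  simp only [map_add, Function.comp]
  abel

/-- A local isometry whose differential is onto has no second fundamental form. -/
theorem localSecondForm_eq_zero [FiniteDimensional ℝ E] [FiniteDimensional ℝ F]
    (h : IsLocalIsometry G U G' V ψ) {x : E} (hx : x ∈ U)
    (hs : Function.Surjective (fderiv ℝ ψ x)) (u v : E) : localSecondForm G G' ψ x u v = 0 := by
  obtain ⟨w, hw⟩ := hs (localSecondForm G G' ψ x u v)
  by_contra hne
  have h1 := h.target.pos _ (h.mapsTo hx) _ hne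
  have h2 := h.localSecondForm_normal hx u v w
  rw [hw] at h2
  exact h1.ne' h2

theorem contDiffAt_localSecondForm [FiniteDimensional ℝ E] [FiniteDimensional ℝ F]
    (h : IsLocalIsometry G U G' V ψ) {x : E} (hx : x ∈ U) (u v : E) :
    ContDiffAt ℝ ∞ (fun y => localSecondForm G G' ψ y u v) x := by
  have h1 := h.contDiffAt_fderiv hx
  have h2 : ContDiffAt ℝ ∞ (fderiv ℝ (fderiv ℝ ψ)) x := h1.fderiv_right (by simp)
  exact (((h2.clm_apply contDiffAt_const).clm_apply contDiffAt_const).add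
    (h.target.contDiffAt_localChristoffel (h.mapsTo hx) (h.contDiffAt hx)
      (h1.clm_apply contDiffAt_const) (h1.clm_apply contDiffAt_const))).sub
    (h1.clm_apply (h.source.contDiffAt_localChristoffel hx contDiffAt_id contDiffAt_const
      contDiffAt_const))

end IsLocalIsometry

end LocalModel

/-! ### Existence of geodesics in a vector space -/

section LocalGeodesic

variable {E : Type*} [NormedAddCommGroup E] [NormedSpace ℝ E] [FiniteDimensional ℝ E]
  {G : E → E →L[ℝ] E →L[ℝ] ℝ} {U : Set E}

/-- Along a solution of the geodesic equation the speed is constant. -/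
theorem IsLocalMetric.hasDerivAt_speed (hG : IsLocalMetric G U) {c : ℝ → E} {t : ℝ}
    (ht : c t ∈ U) (hc : ContDiffAt ℝ ∞ c t) (hacc : localAccel G c t = 0) :
    HasDerivAt (fun s => G (c s) (deriv c s) (deriv c s)) 0 t := by
  have hd := ((contDiffAt_deriv hc).differentiableAt (by simp)).hasDerivAt
  have h := hG.hasDerivAt ht (hc.differentiableAt (by simp)).hasDerivAt hd hd
  rw [eq_neg_of_add_eq_zero_left (show deriv (deriv c) t + _ = 0 from hacc),
    hG.fderiv_eq ht] at h
  convert h using 1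
  simp only [map_neg, neg_apply]
  ring

/-- Short unit-speed geodesics exist with any initial point and unit initial vector, and are smooth:
they are integral curves of the geodesic spray. -/
theorem IsLocalMetric.exists_geodesic (hG : IsLocalMetric G U) {x : E} (hx : x ∈ U) {u : E}
    (hu : G x u u = 1) :
    ∃ (ε : ℝ) (c : ℝ → E), 0 < ε ∧ c 0 = x ∧ deriv c 0 = u ∧ ContDiffOn ℝ ∞ c (Ioo (-ε) ε) ∧
      ∀ t ∈ Ioo (-ε) ε, c t ∈ U ∧ localAccel G c t = 0 ∧
        G (c t) (deriv c t) (deriv c t) = 1 := by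
  -- the geodesic spray
  set f : E × E → E × E := fun z => (z.2, -localChristoffel G z.1 z.2 z.2) with hf
  have hfs : ∀ z : E × E, z.1 ∈ U → ContDiffAt ℝ ∞ f z := fun z hz =>
    contDiffAt_snd.prodMk
      (hG.contDiffAt_localChristoffel hz contDiffAt_fst contDiffAt_snd contDiffAt_snd).neg
  obtain ⟨α, hα0, δ, hδ, hα⟩ :=
    ((hfs (x, u) hx).of_le (m := 1)
      (by simp)).exists_forall_mem_closedBall_exists_eq_forall_mem_Ioo_hasDerivAt₀ 0
  have hcont : ContinuousAt (fun t => (α t).1) 0 :=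
    continuous_fst.continuousAt.comp (hα 0 (by simpa using hδ)).continuousAt
  have hU : (fun t => (α t).1) ⁻¹' U ∈ 𝓝 (0 : ℝ) :=
    hcont.preimage_mem_nhds (hG.isOpen.mem_nhds (by simpa [hα0] using hx))
  obtain ⟨δ', hδ', hball⟩ := Metric.mem_nhds_iff.1 hU
  -- half the radius, so that the closed interval `[-ε, ε]`, on which solutions are smooth, still lies
  -- in both neighbourhoods
  set ε := min δ δ' / 2 with hε
  have hεpos : 0 < ε := by positivity
  have hεδ : ε < δ := by have := min_le_left δ δ'; have := lt_min hδ hδ'; linarith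
  have hεδ' : ε < δ' := by have := min_le_right δ δ'; have := lt_min hδ hδ'; linarith
  have hαd : ∀ t ∈ Icc (-ε) ε, HasDerivAt α (f (α t)) t := fun t ht =>
    hα t ⟨by linarith [ht.1], by linarith [ht.2]⟩
  have hαU : ∀ t ∈ Icc (-ε) ε, (α t).1 ∈ U := fun t ht => hball (by
    rw [Metric.mem_ball, Real.dist_eq, sub_zero, abs_lt]
    exact ⟨by linarith [ht.1], by linarith [ht.2]⟩)
  have hαs : ContDiffOn ℝ ∞ α (Icc (-ε) ε) := by
    refine ODE.contDiffOn_enat_Icc_of_hasDerivWithinAt (n := ⊤) (f := fun _ => f)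
      (u := {z : E × E | z.1 ∈ U}) ?_ (fun t ht => (hαd t ht).hasDerivWithinAt) hαU
    exact fun z hz => ((hfs z.2 hz.2).comp z contDiffAt_snd).contDiffWithinAt
  set c : ℝ → E := fun t => (α t).1 with hc
  have hcd : ∀ t ∈ Icc (-ε) ε, HasDerivAt c (α t).2 t := fun t ht => (hαd t ht).fst
  have hvd : ∀ t ∈ Icc (-ε) ε, HasDerivAt (fun s => (α s).2)
    (-localChristoffel G (c t) (α t).2 (α t).2) t := fun t ht => (hαd t ht).snd
  have h0 : (0 : ℝ) ∈ Ioo (-ε) ε := ⟨by linarith, hεpos⟩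
  have hcs : ContDiffOn ℝ ∞ c (Ioo (-ε) ε) :=
    (contDiff_fst.comp_contDiffOn hαs).mono Ioo_subset_Icc_self
  have hcs' : ∀ t ∈ Ioo (-ε) ε, ContDiffAt ℝ ∞ c t := fun t ht =>
    hcs.contDiffAt (isOpen_Ioo.mem_nhds ht)
  have hacc : ∀ t ∈ Ioo (-ε) ε, localAccel G c t = 0 := fun t ht => by
    have hev : deriv c =ᶠ[𝓝 t] fun s => (α s).2 := by
      filter_upwards [isOpen_Ioo.mem_nhds ht] with s hs
      exact (hcd s (Ioo_subset_Icc_self hs)).deriv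
    have ht' := Ioo_subset_Icc_self ht
    rw [localAccel, hev.deriv_eq, (hvd t ht').deriv, (hcd t ht').deriv, neg_add_cancel]
  refine ⟨ε, c, hεpos, by simp [hc, hα0], by rw [(hcd 0 (Ioo_subset_Icc_self h0)).deriv, hα0],
    hcs, fun t ht => ⟨hαU t (Ioo_subset_Icc_self ht), hacc t ht, ?_⟩⟩
  have hsp : ∀ s ∈ Ioo (-ε) ε, HasDerivAt (fun s => G (c s) (deriv c s) (deriv c s)) 0 s :=
    fun s hs => hG.hasDerivAt_speed (hαU s (Ioo_subset_Icc_self hs)) (hcs' s hs) (hacc s hs)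
  have := isOpen_Ioo.is_const_of_deriv_eq_zero isPreconnected_Ioo
    (fun s hs => (hsp s hs).differentiableAt.differentiableWithinAt)
    (fun s hs => (hsp s hs).deriv) ht h0
  rw [this, (hcd 0 (Ioo_subset_Icc_self h0)).deriv]
  simpa [hc, hα0] using hu

end LocalGeodesic

/-! ### The metric in the preferred charts -/

section Charts

variable {E : Type*} [NormedAddCommGroup E] [NormedSpace ℝ E]
  {M : Type*} [TopologicalSpace M] [ChartedSpace E M] [IsManifold 𝓘(ℝ, E) ∞ M]
  {F : Type*} [NormedAddCommGroup F] [NormedSpace ℝ F]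
  {N : Type*} [TopologicalSpace N] [ChartedSpace F N] [IsManifold 𝓘(ℝ, F) ∞ N]

/-- The Gram form of the metric in the preferred chart at `p`, as a function of the coordinates. -/
def chartMetric (g : Metric E M) (p : M) (x : E) : E →L[ℝ] E →L[ℝ] ℝ :=
  gram g p ((extChartAt 𝓘(ℝ, E) p).symm x)

variable (E F) in
/-- A map between manifolds, read in the preferred charts at `p` and `p'`. -/
def chartMap (ι : M → N) (p : M) (p' : N) : E → F :=
  extChartAt 𝓘(ℝ, F) p' ∘ ι ∘ (extChartAt 𝓘(ℝ, E) p).symm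

variable (E F) in
/-- The set on which `chartMap ι p p'` represents `ι`. -/
def chartDomain (ι : M → N) (p : M) (p' : N) : Set E :=
  (extChartAt 𝓘(ℝ, E) p).target ∩
    (extChartAt 𝓘(ℝ, E) p).symm ⁻¹' (ι ⁻¹' (chartAt F p').source)

theorem extChartAt_mem_target' {p q : M} (hq : q ∈ (chartAt E p).source) :
    extChartAt 𝓘(ℝ, E) p q ∈ (extChartAt 𝓘(ℝ, E) p).target :=
  (extChartAt 𝓘(ℝ, E) p).map_source (by simpa using hq)

theorem extChartAt_symm_extChartAt {p q : M} (hq : q ∈ (chartAt E p).source) :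
    (extChartAt 𝓘(ℝ, E) p).symm (extChartAt 𝓘(ℝ, E) p q) = q :=
  (extChartAt 𝓘(ℝ, E) p).left_inv (by simpa using hq)

theorem coord_eq_continuousLinearMapAt {p q : M} (hq : q ∈ (chartAt E p).source)
    (v : TangentSpace 𝓘(ℝ, E) q) : coord p q v =
      (trivializationAt E (TangentSpace 𝓘(ℝ, E) : M → Type _) p).continuousLinearMapAt ℝ q v := by
  rw [Trivialization.continuousLinearMapAt_apply, Trivialization.linearMapAt_apply, if_pos]
  · rfl
  · simpa using hq

theorem coord_eq_mfderiv {p q : M} (hq : q ∈ (chartAt E p).source)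
    (v : TangentSpace 𝓘(ℝ, E) q) :
    coord p q v = mfderiv 𝓘(ℝ, E) 𝓘(ℝ, E) (extChartAt 𝓘(ℝ, E) p) q v := by
  rw [coord_eq_continuousLinearMapAt hq, TangentBundle.continuousLinearMapAt_trivializationAt hq]
  rfl

theorem coord_smul {p q : M} (hq : q ∈ (chartAt E p).source) (a : ℝ)
    (v : TangentSpace 𝓘(ℝ, E) q) : coord p q (a • v) = a • coord p q v := by
  simp only [coord_eq_continuousLinearMapAt hq, map_smul]

theorem coordField_coord {p q : M} (hq : q ∈ (chartAt E p).source)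
    (v : TangentSpace 𝓘(ℝ, E) q) : coordField p (coord p q v) q = v := by
  rw [coord_eq_continuousLinearMapAt hq]
  exact Trivialization.symmL_continuousLinearMapAt _ (by simpa using hq) v

theorem coord_coordField {p q : M} (hq : q ∈ (chartAt E p).source) (u : E) :
    coord p q (coordField p u q) = u := by
  rw [coord_eq_continuousLinearMapAt hq]
  exact Trivialization.continuousLinearMapAt_symmL _ (by simpa using hq) u

theorem coord_self (p : M) (v : TangentSpace 𝓘(ℝ, E) p) : coord p p v = v := by
  rw [coord_eq_mfderiv (mem_chart_source E p), mfderiv_extChartAt_self]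
  rfl

theorem coordField_self (p : M) (u : TangentSpace 𝓘(ℝ, E) p) : coordField (E := E) p u p = u :=
  (congrArg (fun w : E => coordField p w p) (coord_self p u)).symm.trans
    (coordField_coord (mem_chart_source E p) u)

/-- Inner products computed in the chart at `p`, at any point of its domain. -/
theorem chartMetric_coord (g : Metric E M) {p q : M} (hq : q ∈ (chartAt E p).source)
    (v w : TangentSpace 𝓘(ℝ, E) q) :
    chartMetric g p (extChartAt 𝓘(ℝ, E) p q) (coord p q v) (coord p q w) = g.inner q v w := by
  rw [chartMetric, extChartAt_symm_extChartAt hq, gram_apply, coordField_coord hq,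
    coordField_coord hq]

theorem chartMetric_self (g : Metric E M) (p : M) :
    chartMetric g p (extChartAt 𝓘(ℝ, E) p p) = g.inner p := by
  ext v w
  refine Eq.trans ?_ (chartMetric_coord g (mem_chart_source E p)
    (v : TangentSpace 𝓘(ℝ, E) p) (w : TangentSpace 𝓘(ℝ, E) p))
  exact congrArg₂ (fun a b => chartMetric g p (extChartAt 𝓘(ℝ, E) p p) a b)
    (coord_self p v).symm (coord_self p w).symm

theorem contMDiffOn_coordField (p : M) (u : E) :
    ContMDiffOn 𝓘(ℝ, E) 𝓘(ℝ, E).tangent ∞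
      (fun q => (⟨q, coordField p u q⟩ : TangentBundle 𝓘(ℝ, E) M)) (chartAt E p).source := by
  have hb : (chartAt E p).source =
    (trivializationAt E (TangentSpace 𝓘(ℝ, E) : M → Type _) p).baseSet := by simp
  rw [hb]
  refine (Trivialization.contMDiffOn_section_baseSet_iff (IB := 𝓘(ℝ, E)) (n := ∞)
    (trivializationAt E (TangentSpace 𝓘(ℝ, E) : M → Type _) p)).2 ?_
  exact contMDiffOn_const.congr fun q hq => coord_coordField (hb ▸ hq) u

theorem contMDiffOn_gram_apply (g : Metric E M) (p : M) (u v : E) :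
    ContMDiffOn 𝓘(ℝ, E) 𝓘(ℝ, ℝ) ∞ (fun q => gram g p q u v) (chartAt E p).source := by
  have h : ContMDiffOn 𝓘(ℝ, E) (𝓘(ℝ, E).prod 𝓘(ℝ, ℝ)) ∞
      (fun q => TotalSpace.mk' ℝ (E := Bundle.Trivial M ℝ) q
        (g.inner q (coordField p u q) (coordField p v q))) (chartAt E p).source :=
    ContMDiffOn.clm_bundle_apply₂ (F₁ := E) (F₂ := E)
      g.contMDiff.contMDiffOn (contMDiffOn_coordField p u) (contMDiffOn_coordField p v)
  intro q hq
  exact (contMDiffWithinAt_totalSpace.1 (h q hq)).2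

theorem isLocalMetric_chartMetric [FiniteDimensional ℝ E] (g : Metric E M) (p : M) :
    IsLocalMetric (chartMetric g p) (extChartAt 𝓘(ℝ, E) p).target where
  isOpen := isOpen_extChartAt_target p
  contDiffOn := by
    refine contDiffOn_clm_apply.2 fun u => contDiffOn_clm_apply.2 fun v => ?_
    refine contMDiffOn_iff_contDiffOn.1 ((contMDiffOn_gram_apply g p u v).comp
      (contMDiffOn_extChartAt_symm p) fun x hx => ?_)
    simpa using (extChartAt 𝓘(ℝ, E) p).map_target hx
  symm x _ u v := g.symm _ _ _
  pos x hx u hu := by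
    refine g.pos _ _ fun h => hu ?_
    have hq : (extChartAt 𝓘(ℝ, E) p).symm x ∈ (chartAt E p).source := by
      simpa using (extChartAt 𝓘(ℝ, E) p).map_target hx
    rw [← coord_coordField hq u, show coordField p u ((extChartAt 𝓘(ℝ, E) p).symm x) = 0 from h,
      coord_eq_continuousLinearMapAt hq, map_zero]

theorem dgram_eq_fderiv [FiniteDimensional ℝ E] (g : Metric E M) (p : M) :
    dgram g p = fderiv ℝ (chartMetric g p) (extChartAt 𝓘(ℝ, E) p p) := by
  have hx := extChartAt_mem_target' (mem_chart_source E p)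
  have h1 : HasMFDerivAt 𝓘(ℝ, E) 𝓘(ℝ, E →L[ℝ] E →L[ℝ] ℝ)
      (chartMetric g p ∘ extChartAt 𝓘(ℝ, E) p) p
      ((fderiv ℝ (chartMetric g p) (extChartAt 𝓘(ℝ, E) p p)).comp
        (ContinuousLinearMap.id ℝ E)) := by
    refine HasMFDerivAt.comp (I' := 𝓘(ℝ, E)) p (((isLocalMetric_chartMetric g p).differentiableAt
      hx).hasFDerivAt.hasMFDerivAt) ?_
    exact mfderiv_extChartAt_self (I := 𝓘(ℝ, E)) (x := p) ▸
      (mdifferentiableAt_extChartAt (mem_chart_source E p)).hasMFDerivAt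
  have hev : gram g p =ᶠ[𝓝 p] chartMetric g p ∘ extChartAt 𝓘(ℝ, E) p := by
    filter_upwards [(chartAt E p).open_source.mem_nhds (mem_chart_source E p)] with q hq
    rw [Function.comp, chartMetric, extChartAt_symm_extChartAt hq]
  exact (h1.congr_of_eventuallyEq hev).mfderiv

/-- The Christoffel symbol at `p` is that of the chart metric, at the base point of the chart. -/
theorem christoffel_eq [FiniteDimensional ℝ E] (g : Metric E M) (p : M)
    (u v : TangentSpace 𝓘(ℝ, E) p) :
    christoffel g p u v = localChristoffel (chartMetric g p) (extChartAt 𝓘(ℝ, E) p p) u v := by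
  unfold christoffel localChristoffel koszul localKoszul
  rw [dgram_eq_fderiv, chartMetric_self]
  rfl

end Charts

/-! ### Maps in the preferred charts -/

section ChartMaps

variable {E : Type*} [NormedAddCommGroup E] [NormedSpace ℝ E]
  {M : Type*} [TopologicalSpace M] [ChartedSpace E M] [IsManifold 𝓘(ℝ, E) ∞ M]
  {F : Type*} [NormedAddCommGroup F] [NormedSpace ℝ F]
  {N : Type*} [TopologicalSpace N] [ChartedSpace F N] [IsManifold 𝓘(ℝ, F) ∞ N]
  {g : Metric E M} {h : Metric F N} {ι : M → N}

theorem isOpen_chartDomain (hι : Continuous ι) (p : M) (p' : N) :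
    IsOpen (chartDomain E F ι p p') :=
  (continuousOn_extChartAt_symm p).isOpen_inter_preimage (isOpen_extChartAt_target p)
    ((chartAt F p').open_source.preimage hι)

theorem extChartAt_mem_chartDomain {p q : M} {p' : N} (hq : q ∈ (chartAt E p).source)
    (hq' : ι q ∈ (chartAt F p').source) : extChartAt 𝓘(ℝ, E) p q ∈ chartDomain E F ι p p' :=
  ⟨extChartAt_mem_target' hq, by
    rw [mem_preimage, extChartAt_symm_extChartAt hq]; exact hq'⟩

/-- Every point of the chart domain is the coordinate vector of a point. -/
theorem exists_of_mem_chartDomain {p : M} {p' : N} {x : E} (hx : x ∈ chartDomain E F ι p p') :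
    ∃ q, q ∈ (chartAt E p).source ∧ ι q ∈ (chartAt F p').source ∧
      extChartAt 𝓘(ℝ, E) p q = x :=
  ⟨(extChartAt 𝓘(ℝ, E) p).symm x, by simpa using (extChartAt 𝓘(ℝ, E) p).map_target hx.1, hx.2,
    (extChartAt 𝓘(ℝ, E) p).right_inv hx.1⟩

theorem chartMap_extChartAt {p q : M} (p' : N) (hq : q ∈ (chartAt E p).source) :
    chartMap E F ι p p' (extChartAt 𝓘(ℝ, E) p q) = extChartAt 𝓘(ℝ, F) p' (ι q) := by
  simp only [chartMap, Function.comp, extChartAt_symm_extChartAt hq]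

theorem contDiffOn_chartMap (hι : ContMDiff 𝓘(ℝ, E) 𝓘(ℝ, F) ∞ ι) (p : M) (p' : N) :
    ContDiffOn ℝ ∞ (chartMap E F ι p p') (chartDomain E F ι p p') := by
  refine contMDiffOn_iff_contDiffOn.1 fun x hx => ?_
  have h1 := (contMDiffOn_extChartAt_symm (I := 𝓘(ℝ, E)) (n := ∞) p x hx.1).mono
    (inter_subset_left : chartDomain E F ι p p' ⊆ _)
  exact (contMDiffAt_extChartAt' hx.2).comp_contMDiffWithinAt x
    (hι.contMDiffAt.comp_contMDiffWithinAt x h1)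

/-- The differential of a map, read in charts. -/
theorem coord_mfderiv (hι : ContMDiff 𝓘(ℝ, E) 𝓘(ℝ, F) ∞ ι) {p q : M} {p' : N}
    (hq : q ∈ (chartAt E p).source) (hq' : ι q ∈ (chartAt F p').source)
    (v : TangentSpace 𝓘(ℝ, E) q) :
    coord p' (ι q) (mfderiv 𝓘(ℝ, E) 𝓘(ℝ, F) ι q v) =
      fderiv ℝ (chartMap E F ι p p') (extChartAt 𝓘(ℝ, E) p q) (coord p q v) := by
  have hx := extChartAt_mem_chartDomain hq hq'
  have hd : DifferentiableAt ℝ (chartMap E F ι p p') (extChartAt 𝓘(ℝ, E) p q) :=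
    ((contDiffOn_chartMap hι p p').contDiffAt
      ((isOpen_chartDomain hι.continuous p p').mem_nhds hx)).differentiableAt (by simp)
  have hev : chartMap E F ι p p' ∘ extChartAt 𝓘(ℝ, E) p =ᶠ[𝓝 q] extChartAt 𝓘(ℝ, F) p' ∘ ι := by
    filter_upwards [(chartAt E p).open_source.mem_nhds hq] with r hr
    exact chartMap_extChartAt p' hr
  have hm : MDifferentiableAt 𝓘(ℝ, E) 𝓘(ℝ, F) ι q := hι.mdifferentiableAt (by simp)
  have h1 : HasMFDerivAt 𝓘(ℝ, E) 𝓘(ℝ, F) (extChartAt 𝓘(ℝ, F) p' ∘ ι) q _ :=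
    ((mdifferentiableAt_extChartAt hq').hasMFDerivAt.comp q hm.hasMFDerivAt)
  have h2 : HasMFDerivAt 𝓘(ℝ, E) 𝓘(ℝ, F) (chartMap E F ι p p' ∘ extChartAt 𝓘(ℝ, E) p) q _ :=
    HasMFDerivAt.comp (I' := 𝓘(ℝ, E)) q hd.hasFDerivAt.hasMFDerivAt
      (mdifferentiableAt_extChartAt hq).hasMFDerivAt
  have h3 := hasMFDerivAt_unique (h2.congr_of_eventuallyEq hev.symm) h1
  rw [coord_eq_mfderiv hq', coord_eq_mfderiv hq]
  exact (congrArg (fun L : E →L[ℝ] F => L v) h3).symm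

theorem mfderiv_eq_fderiv_chartMap (hι : ContMDiff 𝓘(ℝ, E) 𝓘(ℝ, F) ∞ ι) (p : M)
    (v : TangentSpace 𝓘(ℝ, E) p) :
    mfderiv 𝓘(ℝ, E) 𝓘(ℝ, F) ι p v =
      fderiv ℝ (chartMap E F ι p (ι p)) (extChartAt 𝓘(ℝ, E) p p) v := by
  refine (coord_self (E := F) (ι p) _).symm.trans ?_
  refine (coord_mfderiv hι (mem_chart_source E p) (mem_chart_source F (ι p)) v).trans ?_
  exact congrArg (fderiv ℝ (chartMap E F ι p (ι p)) (extChartAt 𝓘(ℝ, E) p p)) (coord_self p v)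

/-- In charts, an isometric immersion is an isometric immersion. -/
theorem IsIsometricImmersion.isLocalIsometry [FiniteDimensional ℝ E] [FiniteDimensional ℝ F]
    (hι : IsIsometricImmersion g h ι) (p : M) (p' : N) :
    IsLocalIsometry (chartMetric g p) (chartDomain E F ι p p') (chartMetric h p')
      (extChartAt 𝓘(ℝ, F) p').target (chartMap E F ι p p') where
  source :=
    { isOpen := isOpen_chartDomain hι.smooth.continuous p p'
      contDiffOn := (isLocalMetric_chartMetric g p).contDiffOn.mono inter_subset_left
      symm := fun x hx => (isLocalMetric_chartMetric g p).symm x hx.1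
      pos := fun x hx => (isLocalMetric_chartMetric g p).pos x hx.1 }
  target := isLocalMetric_chartMetric h p'
  contDiffOn := contDiffOn_chartMap hι.smooth p p'
  mapsTo x hx := extChartAt_mem_target' hx.2
  isometric x hx u v := by
    obtain ⟨q, hq, hq', rfl⟩ := exists_of_mem_chartDomain hx
    rw [← coord_coordField hq u, ← coord_coordField hq v, chartMetric_coord g hq,
      ← coord_mfderiv hι.smooth hq hq', ← coord_mfderiv hι.smooth hq hq',
      chartMap_extChartAt p' hq, chartMetric_coord h hq', hι.isometric]

/-- The identity, read in two different charts, is the change of coordinates; it is an isometry. -/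
theorem isIsometricImmersion_id (g : Metric E M) : IsIsometricImmersion g g (fun q : M => q) where
  smooth := contMDiff_id
  isometric p x y := by
    have : mfderiv 𝓘(ℝ, E) 𝓘(ℝ, E) (fun q : M => q) p = ContinuousLinearMap.id ℝ _ := mfderiv_id
    rw [this]
    rfl

theorem eventually_mem_chart_source {γ : ℝ → M} {t : ℝ} (hγ : ContinuousAt γ t) {p : M}
    (hp : γ t ∈ (chartAt E p).source) : ∀ᶠ s in 𝓝 t, γ s ∈ (chartAt E p).source :=
  hγ.preimage_mem_nhds ((chartAt E p).open_source.mem_nhds hp)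

theorem contDiffAt_extChartAt_comp {γ : ℝ → M} {t : ℝ}
    (hγ : ContMDiffAt 𝓘(ℝ, ℝ) 𝓘(ℝ, E) ∞ γ t) {p : M} (hp : γ t ∈ (chartAt E p).source) :
    ContDiffAt ℝ ∞ (extChartAt 𝓘(ℝ, E) p ∘ γ) t :=
  contMDiffAt_iff_contDiffAt.1 ((contMDiffAt_extChartAt' hp).comp t hγ)

theorem coord_velocity {γ : ℝ → M} {t : ℝ} (hγ : MDifferentiableAt 𝓘(ℝ, ℝ) 𝓘(ℝ, E) γ t) {p : M}
    (hp : γ t ∈ (chartAt E p).source) :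
    coord p (γ t) (velocity γ t) = deriv (extChartAt 𝓘(ℝ, E) p ∘ γ) t := by
  rw [coord_eq_mfderiv hp]
  have h1 := (mdifferentiableAt_extChartAt hp).hasMFDerivAt.comp t hγ.hasMFDerivAt
  have h2 : HasFDerivAt (extChartAt 𝓘(ℝ, E) p ∘ γ) (_ : ℝ →L[ℝ] E) t :=
    hasMFDerivAt_iff_hasFDerivAt.1 h1
  exact h2.hasDerivAt.deriv.symm

end ChartMaps

/-! ### Covariant derivatives in the preferred charts -/

section CovariantDerivatives

variable {E : Type*} [NormedAddCommGroup E] [NormedSpace ℝ E]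
  {M : Type*} [TopologicalSpace M] [ChartedSpace E M] [IsManifold 𝓘(ℝ, E) ∞ M]
  {F : Type*} [NormedAddCommGroup F] [NormedSpace ℝ F]
  {N : Type*} [TopologicalSpace N] [ChartedSpace F N] [IsManifold 𝓘(ℝ, F) ∞ N]
  {g : Metric E M} {h : Metric F N} {ι : M → N}

theorem localAccel_congr {G : E → E →L[ℝ] E →L[ℝ] ℝ} {c₁ c₂ : ℝ → E} {t : ℝ}
    (hc : c₁ =ᶠ[𝓝 t] c₂) : localAccel G c₁ t = localAccel G c₂ t := by
  rw [localAccel, localAccel, hc.deriv.deriv_eq, hc.deriv_eq, hc.self_of_nhds]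

variable [FiniteDimensional ℝ E] [FiniteDimensional ℝ F]

/-- The covariant derivative along a curve, in the chart at the current point of the curve. -/
theorem covDerivCurve_eq {γ : ℝ → M} {t : ℝ} (hγ : MDifferentiableAt 𝓘(ℝ, ℝ) 𝓘(ℝ, E) γ t)
    (V : ∀ t : ℝ, TangentSpace 𝓘(ℝ, E) (γ t)) :
    covDerivCurve g γ V t = deriv (fun r => coord (γ t) (γ r) (V r)) t +
      localChristoffel (chartMetric g (γ t)) (extChartAt 𝓘(ℝ, E) (γ t) (γ t))
        (deriv (extChartAt 𝓘(ℝ, E) (γ t) ∘ γ) t) (V t) := by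
  unfold covDerivCurve covDerivAlong
  rw [mfderiv_eq_fderiv, christoffel_eq, ← coord_velocity hγ (mem_chart_source E (γ t))]
  refine congrArg (fun w : E => fderiv ℝ (fun r => coord (γ t) (γ r) (V r)) t 1 +
    localChristoffel (chartMetric g (γ t)) (extChartAt 𝓘(ℝ, E) (γ t) (γ t)) w (V t)) ?_
  exact (coord_self (γ t) (velocity γ t)).symm

theorem eventually_mdifferentiableAt {γ : ℝ → M} {t : ℝ}
    (hγ : ContMDiffAt 𝓘(ℝ, ℝ) 𝓘(ℝ, E) ∞ γ t) :
    ∀ᶠ s in 𝓝 t, MDifferentiableAt 𝓘(ℝ, ℝ) 𝓘(ℝ, E) γ s := by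
  filter_upwards [(contMDiffAt_iff_contMDiffAt_nhds (by simp)).1
    (hγ.of_le (m := 1) (by simp))] with s hs
  exact hs.mdifferentiableAt (by simp)

theorem eventually_coord_velocity {γ : ℝ → M} {t : ℝ} (hγ : ContMDiffAt 𝓘(ℝ, ℝ) 𝓘(ℝ, E) ∞ γ t)
    {p : M} (hp : γ t ∈ (chartAt E p).source) :
    (fun s => coord p (γ s) (velocity γ s)) =ᶠ[𝓝 t] deriv (extChartAt 𝓘(ℝ, E) p ∘ γ) := by
  filter_upwards [eventually_mdifferentiableAt hγ,
    eventually_mem_chart_source hγ.continuousAt hp] with s hs hs'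
  exact coord_velocity hs hs'

theorem covDerivCurve_velocity_self {γ : ℝ → M} {t : ℝ}
    (hγ : ContMDiffAt 𝓘(ℝ, ℝ) 𝓘(ℝ, E) ∞ γ t) :
    covDerivCurve g γ (velocity γ) t =
      localAccel (chartMetric g (γ t)) (extChartAt 𝓘(ℝ, E) (γ t) ∘ γ) t := by
  have hs := mem_chart_source E (γ t)
  have hd := hγ.mdifferentiableAt (by simp)
  rw [covDerivCurve_eq hd, (eventually_coord_velocity hγ hs).deriv_eq, localAccel]
  refine congrArg (fun w : E => deriv (deriv (extChartAt 𝓘(ℝ, E) (γ t) ∘ γ)) t +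
    localChristoffel (chartMetric g (γ t)) (extChartAt 𝓘(ℝ, E) (γ t) (γ t))
      (deriv (extChartAt 𝓘(ℝ, E) (γ t) ∘ γ) t) w) ?_
  exact (coord_self (γ t) (velocity γ t)).symm.trans (coord_velocity hd hs)

/-- The derivative of the components of `dι Y`, for the coordinate field `Y` through `y`. -/
theorem mfderiv_coord_mfderiv_coordField (hι : ContMDiff 𝓘(ℝ, E) 𝓘(ℝ, F) ∞ ι) (p : M) (x y : E) :
    (mfderiv 𝓘(ℝ, E) 𝓘(ℝ, F) (fun r : M => coord (ι p) (ι r)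
      (mfderiv 𝓘(ℝ, E) 𝓘(ℝ, F) ι r (coordField p y r))) p x : F) =
      fderiv ℝ (fderiv ℝ (chartMap E F ι p (ι p))) (extChartAt 𝓘(ℝ, E) p p) x y := by
  have hp := mem_chart_source E p
  have hp' := mem_chart_source F (ι p)
  have hx := extChartAt_mem_chartDomain hp hp'
  set ψ := chartMap E F ι p (ι p) with hψ
  have hev : (fun r : M => coord (ι p) (ι r)
      (mfderiv 𝓘(ℝ, E) 𝓘(ℝ, F) ι r (coordField p y r))) =ᶠ[𝓝 p]
      (fun z => fderiv ℝ ψ z y) ∘ extChartAt 𝓘(ℝ, E) p := by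
    filter_upwards [(chartAt E p).open_source.mem_nhds hp,
      hι.continuous.continuousAt.preimage_mem_nhds
        ((chartAt F (ι p)).open_source.mem_nhds hp')] with r hr hr'
    rw [coord_mfderiv hι hr hr', coord_coordField hr]
    rfl
  have h2 : ContDiffAt ℝ ∞ (fderiv ℝ ψ) (extChartAt 𝓘(ℝ, E) p p) :=
    ((contDiffOn_chartMap hι p (ι p)).contDiffAt
      ((isOpen_chartDomain hι.continuous p (ι p)).mem_nhds hx)).fderiv_right (by simp)
  have hd := (h2.differentiableAt (by simp)).hasFDerivAt.clm_apply
    (hasFDerivAt_const y (extChartAt 𝓘(ℝ, E) p p))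
  have h3 : HasMFDerivAt 𝓘(ℝ, E) 𝓘(ℝ, F) ((fun z => fderiv ℝ ψ z y) ∘ extChartAt 𝓘(ℝ, E) p) p
      _ := HasMFDerivAt.comp (I' := 𝓘(ℝ, E)) p hd.hasMFDerivAt
        (mdifferentiableAt_extChartAt hp).hasMFDerivAt
  rw [(h3.congr_of_eventuallyEq hev).mfderiv, mfderiv_extChartAt_self]
  refine (add_apply _ _ x).trans ((congrArg (· + _) ?_).trans (zero_add _))
  exact map_zero (fderiv ℝ ψ (extChartAt 𝓘(ℝ, E) p p))

theorem mfderiv_coord_coordField (p : M) (x y : E) :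
    (mfderiv 𝓘(ℝ, E) 𝓘(ℝ, E) (fun r : M => coord p r (coordField p y r)) p x : E) = 0 := by
  have hev : (fun r : M => coord p r (coordField p y r)) =ᶠ[𝓝 p] fun _ => y := by
    filter_upwards [(chartAt E p).open_source.mem_nhds (mem_chart_source E p)] with r hr
    exact coord_coordField hr y
  rw [hev.mfderiv_eq, mfderiv_const]
  rfl

theorem covDeriv_coordField (p : M) (x y : E) :
    covDeriv g (coordField p y) p x =
      localChristoffel (chartMetric g p) (extChartAt 𝓘(ℝ, E) p p) x y := by
  have h1 : mfderiv 𝓘(ℝ, E) 𝓘(ℝ, E) (fun q : M => q) p = ContinuousLinearMap.id ℝ _ := mfderiv_id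
  unfold covDeriv covDerivAlong
  rw [h1, christoffel_eq]
  have h2 : localChristoffel (chartMetric g p) (extChartAt 𝓘(ℝ, E) p p) x
      (coordField p y p : E) = localChristoffel (chartMetric g p) (extChartAt 𝓘(ℝ, E) p p) x y :=
    congrArg (localChristoffel (chartMetric g p) (extChartAt 𝓘(ℝ, E) p p) x)
      (coordField_self p y)
  exact (congrArg₂ (fun a b : E => a + b) (mfderiv_coord_coordField p x y) h2).trans (zero_add _)

/-- The second fundamental form in the preferred charts. -/
theorem secondFundamentalForm_eq (hι : ContMDiff 𝓘(ℝ, E) 𝓘(ℝ, F) ∞ ι) (p : M)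
    (x y : TangentSpace 𝓘(ℝ, E) p) :
    secondFundamentalForm g h ι p x y = localSecondForm (chartMetric g p) (chartMetric h (ι p))
      (chartMap E F ι p (ι p)) (extChartAt 𝓘(ℝ, E) p p) x y := by
  have h1 : christoffel h (ι p) (mfderiv 𝓘(ℝ, E) 𝓘(ℝ, F) ι p x)
      (mfderiv 𝓘(ℝ, E) 𝓘(ℝ, F) ι p (coordField (E := E) p y p)) =
      localChristoffel (chartMetric h (ι p)) (chartMap E F ι p (ι p) (extChartAt 𝓘(ℝ, E) p p))
        (fderiv ℝ (chartMap E F ι p (ι p)) (extChartAt 𝓘(ℝ, E) p p) x)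
        (fderiv ℝ (chartMap E F ι p (ι p)) (extChartAt 𝓘(ℝ, E) p p) y) := by
    rw [coordField_self, christoffel_eq, chartMap_extChartAt (ι p) (mem_chart_source E p)]
    exact congrArg₂ (localChristoffel (chartMetric h (ι p)) (extChartAt 𝓘(ℝ, F) (ι p) (ι p)))
      (mfderiv_eq_fderiv_chartMap hι p x) (mfderiv_eq_fderiv_chartMap hι p y)
  have h2 : mfderiv 𝓘(ℝ, E) 𝓘(ℝ, F) ι p (covDeriv g (coordField (E := E) p y) p x) =
      fderiv ℝ (chartMap E F ι p (ι p)) (extChartAt 𝓘(ℝ, E) p p)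
        (localChristoffel (chartMetric g p) (extChartAt 𝓘(ℝ, E) p p) x y) :=
    (mfderiv_eq_fderiv_chartMap hι p _).trans (congrArg _ (covDeriv_coordField (E := E) p x y))
  exact congrArg₂ (fun a b : F => a - b)
    (congrArg₂ (fun a b : F => a + b) (mfderiv_coord_mfderiv_coordField hι p x y) h1) h2

/-- The covariant acceleration of a curve has the same expression in every chart. -/
theorem coord_covDerivCurve_velocity {γ : ℝ → M} {t : ℝ}
    (hγ : ContMDiffAt 𝓘(ℝ, ℝ) 𝓘(ℝ, E) ∞ γ t) {p : M} (hp : γ t ∈ (chartAt E p).source) :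
    coord p (γ t) (covDerivCurve g γ (velocity γ) t) =
      localAccel (chartMetric g p) (extChartAt 𝓘(ℝ, E) p ∘ γ) t := by
  have hs := mem_chart_source E (γ t)
  have hid := isIsometricImmersion_id g
  have hL := hid.isLocalIsometry (γ t) p
  have hx := extChartAt_mem_chartDomain (ι := fun q : M => q) hs hp
  -- in coordinates the differential of the identity is onto
  have key : ∀ v : TangentSpace 𝓘(ℝ, E) (γ t), coord p (γ t) v =
      fderiv ℝ (chartMap E E (fun q : M => q) (γ t) p) (extChartAt 𝓘(ℝ, E) (γ t) (γ t)) v := by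
    intro v
    have h1 := coord_mfderiv hid.smooth hs hp v
    have h2 : mfderiv 𝓘(ℝ, E) 𝓘(ℝ, E) (fun q : M => q) (γ t) = ContinuousLinearMap.id ℝ _ :=
      mfderiv_id
    rw [h2, coord_self] at h1
    exact h1
  have hsurj : Function.Surjective
      (fderiv ℝ (chartMap E E (fun q : M => q) (γ t) p) (extChartAt 𝓘(ℝ, E) (γ t) (γ t))) :=
    fun w => ⟨coordField p w (γ t), by rw [← key, coord_coordField hp]⟩
  have h3 := hL.localAccel_comp (c := extChartAt 𝓘(ℝ, E) (γ t) ∘ γ) hx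
    (contDiffAt_extChartAt_comp hγ hs)
  rw [Function.comp_apply (f := extChartAt 𝓘(ℝ, E) (γ t)) (g := γ),
    hL.localSecondForm_eq_zero hx hsurj, add_zero, ← covDerivCurve_velocity_self hγ, ← key] at h3
  rw [← h3]
  refine localAccel_congr ?_
  filter_upwards [eventually_mem_chart_source hγ.continuousAt hs] with s hs'
  exact chartMap_extChartAt (ι := fun q : M => q) p hs'

/-- The Gauss formula for the extrinsic shape of a curve, in arbitrary charts. -/
theorem coord_covDerivCurve_comp (hι : IsIsometricImmersion g h ι) {γ : ℝ → M} {t : ℝ}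
    (hγ : ContMDiffAt 𝓘(ℝ, ℝ) 𝓘(ℝ, E) ∞ γ t) {p : M} {p' : N} (hp : γ t ∈ (chartAt E p).source)
    (hp' : ι (γ t) ∈ (chartAt F p').source) :
    coord p' (ι (γ t)) (covDerivCurve h (ι ∘ γ) (velocity (ι ∘ γ)) t) =
      fderiv ℝ (chartMap E F ι p p') (extChartAt 𝓘(ℝ, E) p (γ t))
        (coord p (γ t) (covDerivCurve g γ (velocity γ) t)) +
      localSecondForm (chartMetric g p) (chartMetric h p') (chartMap E F ι p p')
        (extChartAt 𝓘(ℝ, E) p (γ t)) (coord p (γ t) (velocity γ t))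
        (coord p (γ t) (velocity γ t)) := by
  have hL := hι.isLocalIsometry p p'
  have hx := extChartAt_mem_chartDomain hp hp'
  rw [coord_covDerivCurve_velocity hγ hp, coord_velocity (hγ.mdifferentiableAt (by simp)) hp]
  refine (coord_covDerivCurve_velocity (hι.smooth.contMDiffAt.comp t hγ) hp').trans ?_
  refine Eq.trans ?_ (hL.localAccel_comp (c := extChartAt 𝓘(ℝ, E) p ∘ γ) hx
    (contDiffAt_extChartAt_comp hγ hp))
  refine localAccel_congr ?_
  filter_upwards [eventually_mem_chart_source hγ.continuousAt hp] with s hs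
  exact (chartMap_extChartAt p' hs).symm

/-- The Gauss formula for a curve which is a geodesic at time `t`. -/
theorem covDerivCurve_comp (hι : IsIsometricImmersion g h ι) {γ : ℝ → M} {t : ℝ}
    (hγ : ContMDiffAt 𝓘(ℝ, ℝ) 𝓘(ℝ, E) ∞ γ t) (hg : covDerivCurve g γ (velocity γ) t = 0) :
    covDerivCurve h (ι ∘ γ) (velocity (ι ∘ γ)) t =
      secondFundamentalForm g h ι (γ t) (velocity γ t) (velocity γ t) := by
  rw [secondFundamentalForm_eq hι.smooth]
  have h1 := coord_covDerivCurve_comp hι hγ (mem_chart_source E (γ t))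
    (mem_chart_source F (ι (γ t)))
  rw [coord_self (γ t), coord_self (γ t), hg] at h1
  refine (coord_self (E := F) (ι (γ t)) _).symm.trans (h1.trans ?_)
  refine (congrArg (· + _) (map_zero _)).trans (zero_add _)

end CovariantDerivatives

/-! ### Isotropy of a symmetric bilinear map, and planar curves -/

section Isotropy

variable {E : Type*} [NormedAddCommGroup E] [NormedSpace ℝ E]
  {F : Type*} [NormedAddCommGroup F] [NormedSpace ℝ F]

theorem exists_unit_smul (B : E →L[ℝ] E →L[ℝ] ℝ) {w : E} (hw : 0 < B w w) :
    ∃ s : ℝ, 0 < s ∧ s ^ 2 = B w w ∧ B (s⁻¹ • w) (s⁻¹ • w) = 1 := by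
  refine ⟨√(B w w), Real.sqrt_pos.2 hw, Real.sq_sqrt hw.le, ?_⟩
  have h1 := Real.sq_sqrt hw.le
  have h2 := (Real.sqrt_pos.2 hw).ne'
  simp only [map_smul, smul_apply, smul_eq_mul]
  field_simp
  exact h1.symm

/-- If `A(x, x) ⊥ A(x, y)` whenever `x` is a unit vector and `y ⊥ x`, then `|A(x, x)|²` takes the
same value on any two unit vectors in the plane of the orthonormal pair `x`, `y`. -/
theorem inner_self_eq_of_orthonormal (B : E →L[ℝ] E →L[ℝ] ℝ) (hB : ∀ u v, B u v = B v u)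
    (B' : F →L[ℝ] F →L[ℝ] ℝ) (hB' : ∀ u v, B' u v = B' v u) (A : E →ₗ[ℝ] E →ₗ[ℝ] F)
    (hA : ∀ u v, A u v = A v u)
    (horth : ∀ x y, B x x = 1 → B x y = 0 → B' (A x x) (A x y) = 0) {x y : E} (hx : B x x = 1)
    (hy : B y y = 1) (hxy : B x y = 0) {c s : ℝ} (hcs : c ^ 2 + s ^ 2 = 1) :
    B' (A (c • x + s • y) (c • x + s • y)) (A (c • x + s • y) (c • x + s • y)) =
      B' (A x x) (A x x) := by
  have h1 := horth x y hx hxy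
  have h2 := horth y x hy (by rw [hB, hxy])
  -- the condition for the rotated pair `(c x + s y, -s x + c y)`
  have rot : ∀ c s : ℝ, c ^ 2 + s ^ 2 = 1 →
      B' (A (c • x + s • y) (c • x + s • y)) (A (c • x + s • y) ((-s) • x + c • y)) = 0 := by
    intro c s h
    refine horth _ _ ?_ ?_ <;>
      simp only [map_add, map_smul, add_apply, smul_apply, smul_eq_mul, hx, hy, hxy, hB y x]
    · linear_combination h
    · ring
  -- two rotations with rational entries give `|A(y, y)|² = |A(x, x)|²` and
  -- `|A(x, x)|² = ⟨A(x, x), A(y, y)⟩ + 2 |A(x, y)|²`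
  have e1 := rot (3 / 5) (4 / 5) (by norm_num)
  have e2 := rot (4 / 5) (3 / 5) (by norm_num)
  simp only [map_add, map_smul, add_apply, smul_apply, smul_eq_mul,
    LinearMap.add_apply, LinearMap.smul_apply, hA y x, smul_add] at e1 e2 h2 ⊢
  rw [hB' (A y y) (A x x), hB' (A x y) (A x x), hB' (A y y) (A x y)] at e1 e2
  rw [hB' (A y y) (A x x), hB' (A x y) (A x x)]
  rw [hB'] at h2
  rw [hB' (A y y) (A x y), h1, h2]
  rw [h1, h2] at e1 e2
  have e3 : B' (A y y) (A y y) = B' (A x x) (A x x) := by linarith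
  have e4 : B' (A x x) (A x x) = B' (A x x) (A y y) + 2 * B' (A x y) (A x y) := by linarith
  rw [e3]
  linear_combination (B' (A x x) (A x x)) * (c ^ 2 + s ^ 2 + 1) * hcs
    - 2 * c ^ 2 * s ^ 2 * e4

/-- A symmetric bilinear map with `A(x, x) ⊥ A(x, y)` for all unit vectors `x` and all `y ⊥ x`
is isotropic. -/
theorem inner_self_eq_of_orthogonal (B : E →L[ℝ] E →L[ℝ] ℝ) (hB : ∀ u v, B u v = B v u)
    (hpos : ∀ v, v ≠ 0 → 0 < B v v) (B' : F →L[ℝ] F →L[ℝ] ℝ) (hB' : ∀ u v, B' u v = B' v u)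
    (A : E →ₗ[ℝ] E →ₗ[ℝ] F) (hA : ∀ u v, A u v = A v u)
    (horth : ∀ x y, B x x = 1 → B x y = 0 → B' (A x x) (A x y) = 0) {x z : E} (hx : B x x = 1)
    (hz : B z z = 1) : B' (A z z) (A z z) = B' (A x x) (A x x) := by
  -- `z` lies in the plane of `x` and the unit vector along `z - B(x, z) x`
  set c := B x z with hc
  have hw : B (z - c • x) (z - c • x) = 1 - c ^ 2 := by
    simp only [map_sub, map_smul, sub_apply, smul_apply, smul_eq_mul, hx, hz, hB z x, ← hc]
    ring
  by_cases h0 : z - c • x = 0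
  · have hzx := sub_eq_zero.1 h0
    have hc2 : c ^ 2 = 1 := by
      rw [h0] at hw
      simp only [map_zero] at hw
      linarith
    rw [hzx]
    simp only [map_smul, LinearMap.smul_apply, smul_apply, smul_eq_mul]
    linear_combination (c ^ 2 + 1) * B' (A x x) (A x x) * hc2
  · obtain ⟨s, hs, hs2, hu⟩ := exists_unit_smul B (hpos _ h0)
    have hxy : B x (s⁻¹ • (z - c • x)) = 0 := by
      simp only [map_sub, map_smul, smul_eq_mul, hx, ← hc]
      ring
    have := inner_self_eq_of_orthonormal B hB B' hB' A hA horth hx hu hxy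
      (c := c) (s := s) (by linarith)
    rwa [smul_smul, mul_inv_cancel₀ hs.ne', one_smul, add_sub_cancel] at this

variable {G : E → E →L[ℝ] E →L[ℝ] ℝ} {U : Set E} {G' : F → F →L[ℝ] F →L[ℝ] ℝ} {V : Set F}
  {ψ : E → F}

/-- If `η` solves the planarity equation along `ψ ∘ c` and `κ η` is normal, then `κ η` is
orthogonal to the second fundamental form `(c', y)` for all `y ⊥ c'`: differentiate
`κ ⟨η, dψ y⟩ = 0`. -/
theorem IsLocalIsometry.inner_localSecondForm_eq_zero [FiniteDimensional ℝ E]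
    [FiniteDimensional ℝ F] (h : IsLocalIsometry G U G' V ψ) {c : ℝ → E} {η : ℝ → F} {κ : ℝ → ℝ}
    {t κ' : ℝ} {η' : F} {x : E} (ht : c t ∈ U) (hc : HasDerivAt c x t) (hη : HasDerivAt η η' t)
    (hκ : HasDerivAt κ κ' t)
    (heq : η' + localChristoffel G' (ψ (c t)) (fderiv ℝ ψ (c t) x) (η t) =
      -(κ t • fderiv ℝ ψ (c t) x))
    (hnormal : ∀ w, ∀ᶠ s in 𝓝 t, κ s * G' (ψ (c s)) (η s) (fderiv ℝ ψ (c s) w) = 0)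
    {y : E} (hy : G (c t) x y = 0) :
    κ t * G' (ψ (c t)) (η t) (localSecondForm G G' ψ (c t) x y) = 0 := by
  have hV := h.mapsTo ht
  have hψc : HasDerivAt (fun s => ψ (c s)) (fderiv ℝ ψ (c t) x) t :=
    (h.differentiableAt ht).hasFDerivAt.comp_hasDerivAt t hc
  have h1 := h.target.hasDerivAt hV hψc hη (h.hasDerivAt_fderiv ht hc (hasDerivAt_const t y))
  have h2 := hκ.mul h1
  have h3 : HasDerivAt (fun s => κ s * G' (ψ (c s)) (η s) (fderiv ℝ ψ (c s) y)) 0 t :=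
    (hasDerivAt_const t (0 : ℝ)).congr_of_eventuallyEq (hnormal y)
  have h4 := h2.unique h3
  have h5 := (hnormal y).self_of_nhds
  have h6 := (hnormal (localChristoffel G (c t) x y)).self_of_nhds
  rw [eq_sub_of_add_eq heq, h.target.fderiv_eq hV] at h4
  have hy' : G' (ψ (c t)) (fderiv ℝ ψ (c t) x) (fderiv ℝ ψ (c t) y) = 0 := by
    rw [← h.isometric _ ht, hy]
  simp only [map_sub, map_neg, map_smul, sub_apply, neg_apply, smul_apply, smul_eq_mul,
    hy', map_zero, add_zero] at h4
  simp only [localSecondForm, map_sub, map_add]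
  -- `κ' ⟨η, dψ y⟩ + κ ⟨η, dψ y⟩' = 0`, where either `κ` or the first summand vanishes at `t`
  rcases mul_eq_zero.1 h5 with h0 | h0
  · rw [h0, zero_mul]
  · rw [h0] at h4
    linear_combination h4 - h6

end Isotropy

/-! ### Geodesics and the second fundamental form of an immersion -/

section Immersions

variable {E : Type*} [NormedAddCommGroup E] [NormedSpace ℝ E] [FiniteDimensional ℝ E]
  {M : Type*} [TopologicalSpace M] [ChartedSpace E M] [IsManifold 𝓘(ℝ, E) ∞ M]
  {F : Type*} [NormedAddCommGroup F] [NormedSpace ℝ F] [FiniteDimensional ℝ F]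
  {N : Type*} [TopologicalSpace N] [ChartedSpace F N] [IsManifold 𝓘(ℝ, F) ∞ N]
  {g : Metric E M} {h : Metric F N} {ι : M → N}

theorem coord_secondFundamentalForm (hι : ContMDiff 𝓘(ℝ, E) 𝓘(ℝ, F) ∞ ι) (p : M)
    (x y : TangentSpace 𝓘(ℝ, E) p) :
    coord (ι p) (ι p) (secondFundamentalForm g h ι p x y) =
      localSecondForm (chartMetric g p) (chartMetric h (ι p)) (chartMap E F ι p (ι p))
        (extChartAt 𝓘(ℝ, E) p p) (coord p p x) (coord p p y) :=
  (coord_self (ι p) _).trans ((secondFundamentalForm_eq hι p x y).trans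
    (congrArg₂ (localSecondForm (chartMetric g p) (chartMetric h (ι p)) (chartMap E F ι p (ι p))
      (extChartAt 𝓘(ℝ, E) p p)) (coord_self p x).symm (coord_self p y).symm))

/-- Local existence of geodesics, with initial data given in a chart. -/
theorem exists_isGeodesic (g : Metric E M) {p q : M} (hq : q ∈ (chartAt E p).source) {u : E}
    (hu : chartMetric g p (extChartAt 𝓘(ℝ, E) p q) u u = 1) :
    ∃ (ε : ℝ) (γ : ℝ → M), 0 < ε ∧ IsGeodesic g γ (Ioo (-ε) ε) ∧ γ 0 = q ∧
      deriv (extChartAt 𝓘(ℝ, E) p ∘ γ) 0 = u ∧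
      ∀ t ∈ Ioo (-ε) ε, γ t ∈ (chartAt E p).source := by
  obtain ⟨ε, c, hε, hc0, hc1, hcs, hc⟩ := (isLocalMetric_chartMetric g p).exists_geodesic
    (extChartAt_mem_target' hq) hu
  set γ : ℝ → M := (extChartAt 𝓘(ℝ, E) p).symm ∘ c with hγ
  have hsrc : ∀ t ∈ Ioo (-ε) ε, γ t ∈ (chartAt E p).source := fun t ht => by
    simpa [hγ] using (extChartAt 𝓘(ℝ, E) p).map_target (hc t ht).1
  have hφγ : ∀ t ∈ Ioo (-ε) ε, extChartAt 𝓘(ℝ, E) p (γ t) = c t := fun t ht =>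
    (extChartAt 𝓘(ℝ, E) p).right_inv (hc t ht).1
  have hev : ∀ t ∈ Ioo (-ε) ε, extChartAt 𝓘(ℝ, E) p ∘ γ =ᶠ[𝓝 t] c := fun t ht => by
    filter_upwards [isOpen_Ioo.mem_nhds ht] with s hs using hφγ s hs
  have hγs : ContMDiffOn 𝓘(ℝ, ℝ) 𝓘(ℝ, E) ∞ γ (Ioo (-ε) ε) :=
    (contMDiffOn_extChartAt_symm p).comp hcs.contMDiffOn fun t ht => (hc t ht).1
  have hγa : ∀ t ∈ Ioo (-ε) ε, ContMDiffAt 𝓘(ℝ, ℝ) 𝓘(ℝ, E) ∞ γ t := fun t ht =>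
    hγs.contMDiffAt (isOpen_Ioo.mem_nhds ht)
  have h0 : (0 : ℝ) ∈ Ioo (-ε) ε := ⟨by linarith, hε⟩
  refine ⟨ε, γ, hε, ⟨⟨hγs, fun t ht => ?_⟩, fun t ht => ?_⟩, ?_, ?_, hsrc⟩
  · rw [← chartMetric_coord g (hsrc t ht), hφγ t ht,
      coord_velocity ((hγa t ht).mdifferentiableAt (by simp)) (hsrc t ht), (hev t ht).deriv_eq]
    exact (hc t ht).2.2
  · rw [← coordField_coord (hsrc t ht) (covDerivCurve g γ (velocity γ) t),
      coord_covDerivCurve_velocity (hγa t ht) (hsrc t ht), localAccel_congr (hev t ht),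
      (hc t ht).2.1]
    exact map_zero _
  · rw [hγ, Function.comp, hc0, extChartAt_symm_extChartAt hq]
  · rw [(hev 0 h0).deriv_eq, hc1]

/-- The second fundamental form is normal to the immersion. -/
theorem secondFundamentalForm_normal (hι : IsIsometricImmersion g h ι) (p : M)
    (x y w : TangentSpace 𝓘(ℝ, E) p) :
    h.inner (ι p) (secondFundamentalForm g h ι p x y) (mfderiv 𝓘(ℝ, E) 𝓘(ℝ, F) ι p w) = 0 := by
  have hp := mem_chart_source E p
  have hp' := mem_chart_source F (ι p)
  rw [← chartMetric_coord h hp', coord_secondFundamentalForm hι.smooth,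
    coord_mfderiv hι.smooth hp hp', ← chartMap_extChartAt (ι p) hp]
  exact (hι.isLocalIsometry p (ι p)).localSecondForm_normal
    (extChartAt_mem_chartDomain hp hp') _ _ _

/-- If the extrinsic shape of a geodesic with velocity `x` is planar, then `α(x, x) ⊥ α(x, y)` for
all `y ⊥ x`. -/
theorem IsGeodesic.inner_secondFundamentalForm_eq_zero (hι : IsIsometricImmersion g h ι)
    {γ : ℝ → M} {J : Set ℝ} (hJ : IsOpen J) (hγ : IsGeodesic g γ J) (hpl : IsPlanar h (ι ∘ γ) J)
    {t : ℝ} (ht : t ∈ J) {y : TangentSpace 𝓘(ℝ, E) (γ t)}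
    (hy : g.inner (γ t) (velocity γ t) y = 0) :
    h.inner (ι (γ t)) (secondFundamentalForm g h ι (γ t) (velocity γ t) (velocity γ t))
      (secondFundamentalForm g h ι (γ t) (velocity γ t) y) = 0 := by
  obtain ⟨hus, Y, κ, hκ, hY⟩ := hpl
  have hp := mem_chart_source E (γ t)
  have hp' := mem_chart_source F (ι (γ t))
  have hγa : ∀ s ∈ J, ContMDiffAt 𝓘(ℝ, ℝ) 𝓘(ℝ, E) ∞ γ s := fun s hs =>
    hγ.smooth.contMDiffAt (hJ.mem_nhds hs)
  have hιγa : ContMDiffAt 𝓘(ℝ, ℝ) 𝓘(ℝ, F) ∞ (ι ∘ γ) t := hus.smooth.contMDiffAt (hJ.mem_nhds ht)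
  have hL := hι.isLocalIsometry (γ t) (ι (γ t))
  have hx := extChartAt_mem_chartDomain (ι := ι) hp hp'
  have hd := (hγa t ht).mdifferentiableAt (by simp)
  have hd' := hιγa.mdifferentiableAt (by simp)
  have hcd := ((contDiffAt_extChartAt_comp (hγa t ht) hp).differentiableAt (by simp)).hasDerivAt
  set φ := extChartAt 𝓘(ℝ, E) (γ t) with hφ
  set φ' := extChartAt 𝓘(ℝ, F) (ι (γ t)) with hφ'
  set ψ := chartMap E F ι (γ t) (ι (γ t)) with hψ
  -- the normal field, with its values in the tangent spaces at `ι (γ s)` rather than `(ι ∘ γ) s`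
  let Y' : ∀ s, TangentSpace 𝓘(ℝ, F) (ι (γ s)) := Y
  set η : ℝ → F := fun s => coord (ι (γ t)) (ι (γ s)) (Y' s) with hη
  have hηs : ContDiffAt ℝ ∞ η t :=
    contMDiffAt_iff_contDiffAt.1
      (contMDiffAt_totalSpace.1 (hY.smooth.contMDiffAt (hJ.mem_nhds ht))).2
  have hαY : ∀ s ∈ J,
      secondFundamentalForm g h ι (γ s) (velocity γ s) (velocity γ s) = κ s • Y' s := fun s hs =>
    (covDerivCurve_comp hι (hγa s hs) (hγ.geodesic s hs)).symm.trans (hY.deriv_T s hs)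
  have hvel : deriv (φ' ∘ ι ∘ γ) t = fderiv ℝ ψ (φ (γ t)) (deriv (φ ∘ γ) t) := by
    have hev : φ' ∘ ι ∘ γ =ᶠ[𝓝 t] ψ ∘ φ ∘ γ := by
      filter_upwards [eventually_mem_chart_source (hγa t ht).continuousAt hp] with s hs
      exact (chartMap_extChartAt (ι (γ t)) hs).symm
    rw [hev.deriv_eq]
    exact ((hL.differentiableAt hx).hasFDerivAt.comp_hasDerivAt t hcd).deriv
  have hvelF : (velocity (ι ∘ γ) t : F) = deriv (φ' ∘ ι ∘ γ) t :=
    (coord_self (E := F) (ι (γ t)) _).symm.trans (coord_velocity hd' hp')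
  have hηt : η t = (Y t : F) := coord_self (ι (γ t)) (Y' t)
  -- the second planarity equation in coordinates
  have heq : deriv η t + localChristoffel (chartMetric h (ι (γ t))) (φ' (ι (γ t)))
      (deriv (φ' ∘ ι ∘ γ) t) (η t) = -(κ t • deriv (φ' ∘ ι ∘ γ) t) := by
    rw [← hvelF, hηt]
    refine Eq.trans ?_ ((covDerivCurve_eq hd' Y).symm.trans (hY.deriv_Y t ht))
    rw [hvelF]
    rfl
  have key := hL.inner_localSecondForm_eq_zero (c := φ ∘ γ) (η := η) (κ := κ) (t := t) hx hcd
    (hηs.differentiableAt (by simp)).hasDerivAt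
    ((hκ.contDiffAt (hJ.mem_nhds ht)).differentiableAt (by simp)).hasDerivAt ?_ ?_
    (y := coord (γ t) (γ t) y) ?_
  · rw [hαY t ht, ← chartMetric_coord h hp', coord_smul hp', coord_secondFundamentalForm hι.smooth,
      coord_velocity hd hp, ← chartMap_extChartAt (ι (γ t)) hp, map_smul]
    exact key
  · rw [Function.comp_apply, ← hvel, hψ, hφ, chartMap_extChartAt (ι (γ t)) hp]
    exact heq
  · intro w
    filter_upwards [hJ.mem_nhds ht, eventually_mem_chart_source (hγa t ht).continuousAt hp,
      eventually_mem_chart_source hιγa.continuousAt hp'] with s hs hs1 hs2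
    replace hs2 : ι (γ s) ∈ (chartAt F (ι (γ t))).source := hs2
    have h1 := secondFundamentalForm_normal hι (γ s) (velocity γ s) (velocity γ s)
      (coordField (γ t) w (γ s))
    rw [hαY s hs, ← chartMetric_coord h hs2, coord_smul hs2, coord_mfderiv hι.smooth hs1 hs2,
      coord_coordField hs1, ← chartMap_extChartAt (ι (γ t)) hs1, map_smul] at h1
    exact h1
  · rw [← hy, ← chartMetric_coord g hp, coord_velocity hd hp]
    rfl

end Immersions

/-! ### Extrinsic shapes of geodesics -/

section ShapesOfGeodesics

variable {E : Type*} [NormedAddCommGroup E] [NormedSpace ℝ E] [FiniteDimensional ℝ E]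
  {M : Type*} [TopologicalSpace M] [ChartedSpace E M] [IsManifold 𝓘(ℝ, E) ∞ M]
  {F : Type*} [NormedAddCommGroup F] [NormedSpace ℝ F] [FiniteDimensional ℝ F]
  {N : Type*} [TopologicalSpace N] [ChartedSpace F N] [IsManifold 𝓘(ℝ, F) ∞ N]
  {g : Metric E M} {h : Metric F N} {ι : M → N}

/-- The orthogonality relation for an arbitrary unit vector `u` at `p`, in the preferred charts: `u`
is the initial velocity of a geodesic. -/
theorem localSecondForm_orthogonal (hι : IsIsometricImmersion g h ι)
    (hpl : ∀ (γ : ℝ → M) (J : Set ℝ), IsOpen J → J.OrdConnected →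
      IsGeodesic g γ J → IsPlanar h (ι ∘ γ) J) (p : M) {u v : E}
    (hu : chartMetric g p (extChartAt 𝓘(ℝ, E) p p) u u = 1)
    (huv : chartMetric g p (extChartAt 𝓘(ℝ, E) p p) u v = 0) :
    chartMetric h (ι p) (extChartAt 𝓘(ℝ, F) (ι p) (ι p))
      (localSecondForm (chartMetric g p) (chartMetric h (ι p)) (chartMap E F ι p (ι p))
        (extChartAt 𝓘(ℝ, E) p p) u u)
      (localSecondForm (chartMetric g p) (chartMetric h (ι p)) (chartMap E F ι p (ι p))
        (extChartAt 𝓘(ℝ, E) p p) u v) = 0 := by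
  obtain ⟨ε, γ, hε, hγ, rfl, hγu, -⟩ := exists_isGeodesic g (mem_chart_source E p) hu
  have hp := mem_chart_source E (γ 0)
  have hp' := mem_chart_source F (ι (γ 0))
  have h0 : (0 : ℝ) ∈ Ioo (-ε) ε := ⟨by linarith, hε⟩
  have hd : MDifferentiableAt 𝓘(ℝ, ℝ) 𝓘(ℝ, E) γ 0 :=
    (hγ.smooth.contMDiffAt (isOpen_Ioo.mem_nhds h0)).mdifferentiableAt (by simp)
  have hy : g.inner (γ 0) (velocity γ 0) (coordField (γ 0) v (γ 0)) = 0 := by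
    rw [← chartMetric_coord g hp, coord_velocity hd hp, coord_coordField hp, hγu, huv]
  have key := hγ.inner_secondFundamentalForm_eq_zero hι isOpen_Ioo
    (hpl γ _ isOpen_Ioo ordConnected_Ioo hγ) h0 hy
  rwa [← chartMetric_coord h hp', coord_secondFundamentalForm hι.smooth,
    coord_secondFundamentalForm hι.smooth, coord_velocity hd hp, coord_coordField hp, hγu] at key

/-- An immersion for which the extrinsic shapes of geodesics are planar is totally isotropic. -/
theorem isTotallyIsotropic_of_planar (hι : IsIsometricImmersion g h ι)
    (hpl : ∀ (γ : ℝ → M) (J : Set ℝ), IsOpen J → J.OrdConnected →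
      IsGeodesic g γ J → IsPlanar h (ι ∘ γ) J) : IsTotallyIsotropic g h ι := by
  intro p
  by_cases hex : ∃ x : TangentSpace 𝓘(ℝ, E) p, g.inner p x x = 1
  · obtain ⟨x₀, hx₀⟩ := hex
    refine ⟨h.inner (ι p) (secondFundamentalForm g h ι p x₀ x₀)
      (secondFundamentalForm g h ι p x₀ x₀), fun x hx => ?_⟩
    have hp := mem_chart_source E p
    have hp' := mem_chart_source F (ι p)
    have hL := hι.isLocalIsometry p (ι p)
    have hm := extChartAt_mem_chartDomain (ι := ι) hp hp'
    have hm' := extChartAt_mem_target' hp'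
    let A : E →ₗ[ℝ] E →ₗ[ℝ] F := LinearMap.mk₂ ℝ
      (localSecondForm (chartMetric g p) (chartMetric h (ι p)) (chartMap E F ι p (ι p))
        (extChartAt 𝓘(ℝ, E) p p))
      (fun u₁ u₂ v => IsLocalIsometry.localSecondForm_add_left _ _ _ _)
      (fun a u v => IsLocalIsometry.localSecondForm_smul_left _ _ _ _)
      (fun u v₁ v₂ => hL.localSecondForm_add_right hm _ _ _)
      (fun a u v => hL.localSecondForm_smul_right hm _ _ _)
    rw [← chartMetric_coord g hp] at hx hx₀
    rw [← chartMetric_coord h hp', ← chartMetric_coord h hp',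
      coord_secondFundamentalForm hι.smooth, coord_secondFundamentalForm hι.smooth]
    exact inner_self_eq_of_orthogonal _ (hL.source.symm _ hm) (hL.source.pos _ hm) _
      (hL.target.symm _ hm') A (fun u v => hL.localSecondForm_symm hm u v)
      (fun u v hu huv => localSecondForm_orthogonal hι hpl p hu huv) hx₀ hx
  · exact ⟨0, fun x hx => (hex ⟨x, hx⟩).elim⟩

theorem IsCircle.isPlanar {γ : ℝ → N} {J : Set ℝ} (hγ : IsCircle h γ J) : IsPlanar h γ J := by
  obtain ⟨hu, Y, k, -, hY⟩ := hγ
  exact ⟨hu, Y, fun _ => k, contDiffOn_const, hY⟩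

/-- If the extrinsic shape of a geodesic is a circle, then `|α(T, T)|²` is a positive constant
along the geodesic. -/
theorem IsGeodesic.exists_inner_secondFundamentalForm_eq (hι : IsIsometricImmersion g h ι)
    {γ : ℝ → M} {J : Set ℝ} (hJ : IsOpen J) (hγ : IsGeodesic g γ J) (hc : IsCircle h (ι ∘ γ) J) :
    ∃ k : ℝ, 0 < k ∧ ∀ t ∈ J,
      h.inner (ι (γ t)) (secondFundamentalForm g h ι (γ t) (velocity γ t) (velocity γ t))
        (secondFundamentalForm g h ι (γ t) (velocity γ t) (velocity γ t)) = k := by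
  obtain ⟨hu, Y, k, hk, hY⟩ := hc
  -- `k²`, in the form in which bilinearity produces it
  refine ⟨k * (k * 1), by positivity, fun t ht => ?_⟩
  let Y' : ∀ s, TangentSpace 𝓘(ℝ, F) (ι (γ s)) := Y
  have h1 : secondFundamentalForm g h ι (γ t) (velocity γ t) (velocity γ t) = k • Y' t :=
    (covDerivCurve_comp hι (hγ.smooth.contMDiffAt (hJ.mem_nhds ht))
      (hγ.geodesic t ht)).symm.trans (hY.deriv_T t ht)
  have h2 : h.inner (ι (γ t)) (Y' t) (Y' t) = 1 := hY.unit t ht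
  rw [h1, map_smul, map_smul, smul_apply, smul_eq_mul, smul_eq_mul, h2]

/-- `|α(T, T)|²` along a geodesic, in arbitrary charts. -/
theorem IsGeodesic.inner_secondFundamentalForm_eq_chart (hι : IsIsometricImmersion g h ι)
    {γ : ℝ → M} {J : Set ℝ} (hJ : IsOpen J) (hγ : IsGeodesic g γ J) {t : ℝ} (ht : t ∈ J) {p : M}
    {p' : N} (hp : γ t ∈ (chartAt E p).source) (hp' : ι (γ t) ∈ (chartAt F p').source) {u : E}
    (hu : deriv (extChartAt 𝓘(ℝ, E) p ∘ γ) t = u) :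
    h.inner (ι (γ t)) (secondFundamentalForm g h ι (γ t) (velocity γ t) (velocity γ t))
        (secondFundamentalForm g h ι (γ t) (velocity γ t) (velocity γ t)) =
      chartMetric h p' (chartMap E F ι p p' (extChartAt 𝓘(ℝ, E) p (γ t)))
        (localSecondForm (chartMetric g p) (chartMetric h p') (chartMap E F ι p p')
          (extChartAt 𝓘(ℝ, E) p (γ t)) u u)
        (localSecondForm (chartMetric g p) (chartMetric h p') (chartMap E F ι p p')
          (extChartAt 𝓘(ℝ, E) p (γ t)) u u) := by
  have hγa := hγ.smooth.contMDiffAt (hJ.mem_nhds ht)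
  have h1 := coord_covDerivCurve_comp hι hγa hp hp'
  rw [hγ.geodesic t ht, coord_velocity (hγa.mdifferentiableAt (by simp)) hp, hu,
    coord_eq_continuousLinearMapAt hp 0, map_zero, map_zero, zero_add] at h1
  have h2 : coord p' (ι (γ t))
      (secondFundamentalForm g h ι (γ t) (velocity γ t) (velocity γ t)) = _ :=
    (congrArg (coord p' (ι (γ t))) (covDerivCurve_comp hι hγa (hγ.geodesic t ht))).symm.trans h1
  rw [← chartMetric_coord h hp', h2, chartMap_extChartAt p' hp]

/-- If the extrinsic shapes of geodesics are circles, the isotropy function is locally constant: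
in a chart it is a differentiable function whose derivative vanishes along every geodesic. -/
theorem eventually_isotropy_eq (hι : IsIsometricImmersion g h ι) (hE : 0 < Module.finrank ℝ E)
    (hc : ∀ (γ : ℝ → M) (J : Set ℝ), IsOpen J → J.OrdConnected →
      IsGeodesic g γ J → IsCircle h (ι ∘ γ) J) {l : M → ℝ}
    (hl : ∀ p, IsIsotropicAt g h ι p (l p)) (p : M) : ∀ᶠ q in 𝓝 p, l q = l p := by
  have hL := hι.isLocalIsometry p (ι p)
  set G := chartMetric g p with hG
  set G' := chartMetric h (ι p) with hG'
  set ψ := chartMap E F ι p (ι p) with hψ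
  set U := chartDomain E F ι p (ι p) with hU
  set φ := extChartAt 𝓘(ℝ, E) p with hφ
  have : Nontrivial E := Module.finrank_pos_iff.1 hE
  obtain ⟨u₀, hu₀⟩ := exists_ne (0 : E)
  -- the isotropy function in coordinates
  set f : E → ℝ := fun x => G' (ψ x) (localSecondForm G G' ψ x u₀ u₀)
    (localSecondForm G G' ψ x u₀ u₀) / (G x u₀ u₀) ^ 2 with hf
  have isotropy_eq : ∀ {γ : ℝ → M} {J : Set ℝ}, IsOpen J → IsGeodesic g γ J → ∀ t ∈ J,
      l (γ t) = h.inner (ι (γ t))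
        (secondFundamentalForm g h ι (γ t) (velocity γ t) (velocity γ t))
        (secondFundamentalForm g h ι (γ t) (velocity γ t) (velocity γ t)) :=
    fun _ hγ t ht => (hl _ _ (hγ.unit_speed t ht)).symm
  have f_eq : ∀ q ∈ (chartAt E p).source, ι q ∈ (chartAt F (ι p)).source → f (φ q) = l q := by
    intro q hq hq'
    have hx := extChartAt_mem_chartDomain (ι := ι) hq hq'
    obtain ⟨s, hs, hs2, hu⟩ := exists_unit_smul (G (φ q)) (hL.source.pos _ hx u₀ hu₀)
    obtain ⟨ε, γ, hε, hγ, rfl, hγu, -⟩ := exists_isGeodesic g hq hu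
    have h0 : (0 : ℝ) ∈ Ioo (-ε) ε := ⟨by linarith, hε⟩
    have hA : localSecondForm G G' ψ (φ (γ 0)) (s⁻¹ • u₀) (s⁻¹ • u₀) =
        (s⁻¹ * s⁻¹) • localSecondForm G G' ψ (φ (γ 0)) u₀ u₀ := by
      rw [IsLocalIsometry.localSecondForm_smul_left, hL.localSecondForm_smul_right hx, smul_smul]
    have hval : l (γ 0) = G' (ψ (φ (γ 0)))
        (localSecondForm G G' ψ (φ (γ 0)) (s⁻¹ • u₀) (s⁻¹ • u₀))
        (localSecondForm G G' ψ (φ (γ 0)) (s⁻¹ • u₀) (s⁻¹ • u₀)) :=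
      (isotropy_eq isOpen_Ioo hγ 0 h0).trans
        (hγ.inner_secondFundamentalForm_eq_chart hι isOpen_Ioo h0 hq hq' hγu)
    rw [hval, hA, hf]
    simp only [map_smul, smul_apply, smul_eq_mul, ← hs2]
    field_simp
  have f_deriv : ∀ x ∈ U, HasFDerivAt f (0 : E →L[ℝ] ℝ) x := by
    intro x hx
    have hfd : DifferentiableAt ℝ f x := by
      have hA := hL.contDiffAt_localSecondForm hx u₀ u₀
      have h1 : ContDiffAt ℝ ∞ (fun y => G' (ψ y)) x :=
        ContDiffAt.comp x (g := G') (hL.target.contDiffAt (hL.mapsTo hx)) (hL.contDiffAt hx)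
      have h2 : ContDiffAt ℝ ∞ (fun y => G y u₀ u₀) x :=
        ((hL.source.contDiffAt hx).clm_apply contDiffAt_const).clm_apply contDiffAt_const
      exact (((h1.clm_apply hA).clm_apply hA).div (h2.pow 2)
        (pow_ne_zero 2 (hL.source.pos _ hx u₀ hu₀).ne')).differentiableAt (by simp)
    have hzero : fderiv ℝ f x = 0 := by
      ext w
      by_cases hw : w = 0
      · simp [hw]
      obtain ⟨q, hq, hq', rfl⟩ := exists_of_mem_chartDomain hx
      obtain ⟨s, hs, hs2, hu⟩ := exists_unit_smul (G (φ q)) (hL.source.pos _ hx w hw)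
      obtain ⟨ε, γ, hε, hγ, rfl, hγu, hsrc⟩ := exists_isGeodesic g hq hu
      have h0 : (0 : ℝ) ∈ Ioo (-ε) ε := ⟨by linarith, hε⟩
      have hγa := hγ.smooth.contMDiffAt (isOpen_Ioo.mem_nhds h0)
      obtain ⟨k, -, hk⟩ := hγ.exists_inner_secondFundamentalForm_eq hι isOpen_Ioo
        (hc γ _ isOpen_Ioo ordConnected_Ioo hγ)
      have hev : f ∘ φ ∘ γ =ᶠ[𝓝 0] fun _ => k := by
        filter_upwards [isOpen_Ioo.mem_nhds h0,
          eventually_mem_chart_source (hι.smooth.continuous.continuousAt.comp hγa.continuousAt) hq']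
          with t ht ht'
        exact (f_eq _ (hsrc t ht) ht').trans ((isotropy_eq isOpen_Ioo hγ t ht).trans (hk t ht))
      have hd := ((contDiffAt_extChartAt_comp hγa hq).differentiableAt (by simp)).hasDerivAt
      rw [hγu] at hd
      have h1 := (hfd.hasFDerivAt.comp_hasDerivAt (0 : ℝ) hd).unique
        ((hasDerivAt_const (0 : ℝ) k).congr_of_eventuallyEq hev)
      rw [map_smul, smul_eq_mul] at h1
      exact (mul_eq_zero.1 h1).resolve_left (inv_ne_zero hs.ne')
    exact hzero ▸ hfd.hasFDerivAt
  have hp := mem_chart_source E p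
  have hp' := mem_chart_source F (ι p)
  have hφp := extChartAt_mem_chartDomain (ι := ι) hp hp'
  obtain ⟨r, hr, hball⟩ := Metric.isOpen_iff.1 hL.source.isOpen _ hφp
  have hφc : ContinuousAt φ p := continuousAt_extChartAt p
  filter_upwards [(chartAt E p).open_source.mem_nhds hp,
    hι.smooth.continuous.continuousAt.preimage_mem_nhds
      ((chartAt F (ι p)).open_source.mem_nhds hp'),
    hφc.preimage_mem_nhds (Metric.ball_mem_nhds _ hr)] with q hq hq' hqb
  rw [← f_eq q hq hq', ← f_eq p hp hp']
  exact Metric.isOpen_ball.is_const_of_fderiv_eq_zero (convex_ball _ _).isPreconnected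
    (fun x hx => (f_deriv x (hball hx)).differentiableAt.differentiableWithinAt)
    (fun x hx => (f_deriv x (hball hx)).fderiv) hqb (Metric.mem_ball_self hr)

end ShapesOfGeodesics

end RiemannianGeometry

end

open RiemannianGeometry in
theorem mainTheorem3
    {E : Type*} [NormedAddCommGroup E] [NormedSpace ℝ E] [FiniteDimensional ℝ E]
    {M : Type*} [TopologicalSpace M] [T2Space M] [ChartedSpace E M] [IsManifold 𝓘(ℝ, E) ∞ M]
    {E' : Type*} [NormedAddCommGroup E'] [NormedSpace ℝ E'] [FiniteDimensional ℝ E']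
    {Q : Type*} [TopologicalSpace Q] [T2Space Q] [ChartedSpace E' Q] [IsManifold 𝓘(ℝ, E') ∞ Q]
    (g : RiemannianGeometry.Metric E M) (gQ : RiemannianGeometry.Metric E' Q)
    (ι : M → Q) (hι : IsIsometricImmersion g gQ ι) :
    ((∀ (γ : ℝ → M) (J : Set ℝ), IsOpen J → J.OrdConnected →
        IsGeodesic g γ J → IsPlanar gQ (ι ∘ γ) J) →
      IsTotallyIsotropic g gQ ι) ∧
    (ConnectedSpace M → 0 < Module.finrank ℝ E →
      (∀ (γ : ℝ → M) (J : Set ℝ), IsOpen J → J.OrdConnected →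
        IsGeodesic g γ J → IsCircle gQ (ι ∘ γ) J) →
      ¬ IsTotallyGeodesic g gQ ι ∧ IsConstantIsotropic g gQ ι) := by
  refine ⟨isTotallyIsotropic_of_planar hι, fun hM hE hc => ⟨fun htg => ?_, ?_⟩⟩
  · obtain ⟨p⟩ := hM.toNonempty
    have : Nontrivial E := Module.finrank_pos_iff.1 hE
    obtain ⟨w, hw⟩ := exists_ne (0 : E)
    obtain ⟨s, -, -, hu⟩ := exists_unit_smul _ ((isLocalMetric_chartMetric g p).pos _
      (extChartAt_mem_target' (mem_chart_source E p)) w hw)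
    obtain ⟨ε, γ, hε, hγ, -, -, -⟩ := exists_isGeodesic g (mem_chart_source E p) hu
    obtain ⟨k, hk, hγk⟩ := hγ.exists_inner_secondFundamentalForm_eq hι isOpen_Ioo
      (hc γ _ isOpen_Ioo ordConnected_Ioo hγ)
    have h0 := hγk 0 ⟨by linarith, hε⟩
    rw [htg, map_zero] at h0
    exact hk.ne h0
  · choose l hl using isTotallyIsotropic_of_planar hι
      fun γ J hJ hJ' hγ => (hc γ J hJ hJ' hγ).isPlanar
    have hloc : IsLocallyConstant l := (IsLocallyConstant.iff_eventually_eq l).2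
      (eventually_isotropy_eq hι hE hc hl)
    obtain ⟨p₀⟩ := hM.toNonempty
    exact ⟨l p₀, fun p => hloc.apply_eq_of_preconnectedSpace p p₀ ▸ hl p⟩
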